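/- Let $\mathbb S^5\subset\mathbb C^3$ be the unit sphere with its round metric $g$ and Levi-Civita connection $\nabla^g$ (which exists), with $\mathrm{SU}(3)$ acting by matrix multiplication; for $\sigma\in\mathrm{SU}(3)$ write $\tau_\sigma(X)$ for the push-forward of a vector field $X$ by $p\mapsto\sigma p$. All connections $\nabla$ below are smooth affine connections on $\mathbb S^5$. Such a $\nabla$ is $\mathrm{SU}(3)$-invariant if $\tau_\sigma(\nabla_XY)=\nabla_{\tau_\sigma(X)}\tau_\sigma(Y)$ for all $\sigma\in \mathrm{SU}(3)$ and all smooth vector fields $X,Y$; it is metric if $\nabla g=0$; and it has totally skew-symmetric torsion if $(X,Y,Z)\mapsto g(T^\nabla(X,Y),Z)$ is a $3$-form, where $T^\nabla(X,Y)=\nabla_XY-\nabla_YX-[X,Y]$. Let $N_z=z$ be the outward unit normal, $\xi_z=-\mathbf i z$, and let $\psi,\eta$ be defined by the decomposition $\mathbf iX=\psi(X)+\eta(X)N$ into tangent and normal parts; put $\Phi(X,Y)=g(X,\psi(Y))$. Identify $(z_1,z_2,z_3)\in\mathbb C^3$ with $z_1e_1+z_2e_2+z_3e_4\in\mathrm{Im}\,\mathbb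 O$, where $x+\mathbf iy$ is read as $x+ye_7$ and the octonion product is given by $e_i^2=-1$, $e_ie_j=-e_je_i$ for $i\ne j$, and $e_ie_{i+1}=e_{i+3}$, $e_{i+1}e_{i+3}=e_i$, $e_{i+3}e_i=e_{i+1}$ (indices modulo $7$). Let $u\times v=\mathrm{Im}(uv)$ and let $\widehat\psi(X)$ be the component of $N\times X$ tangent to $\mathbb S^5$ (so $N\times X=\widehat\psi(X)-\eta(X)e_7$). Then: (1) A connection $\nabla$ is $\mathrm{SU}(3)$-invariant, metric and with totally skew-symmetric torsion if and only if there are $r\in\mathbb R$, $q\in\mathbb C$ such that, for all smooth vector fields $X,Y$, $$\begin{aligned}\nabla_XY=\nabla^g_XY&+r\big(\Phi(X,Y)\xi-\eta(X)\psi(Y)+\eta(Y)\psi(X)\big)\\&+\mathrm{Re}(q)\big(\eta(Y)\psi(\widehat\psi(X))-\eta(X)\psi(\widehat\psi(Y))+\Phi(\widehat\psi(X),Y)\xi\big)\\&+\mathrm{Im}(q)\big(\eta(X)\widehat\psi(Y)-\eta(Y)\widehat\psi(X)+g(\widehat\psi(X),Y)\xi\big).\end{aligned}$$ (2) For every connection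 $\nabla$ of this form, the symmetric part of its Ricci tensor $\mathrm{Ric}^\nabla(Y,Z)=\mathrm{tr}(X\mapsto R^\nabla(X,Y)Z)$, with $R^\nabla(X,Y)Z=\nabla_X\nabla_YZ-\nabla_Y\nabla_XZ-\nabla_{[X,Y]}Z$, is $$\mathrm{Sym}(\mathrm{Ric}^\nabla)=\big(4-2(r^2+|q|^2)\big)\,g-2(r^2+|q|^2)\,\eta\otimes\eta.$$ (3) Call $(\mathbb S^5,g,\nabla)$ $\nabla$-Einstein if $\nabla$ is metric with totally skew-symmetric torsion and $\mathrm{Sym}(\mathrm{Ric}^\nabla)=\frac{s^\nabla}{5}\,g$, where $s^\nabla$ is the scalar curvature ($g$-trace of $\mathrm{Ric}^\nabla$). For an $\mathrm{SU}(3)$-invariant metric connection $\nabla$, $(\mathbb S^5,g,\nabla)$ is $\nabla$-Einstein if and only if $\nabla=\nabla^g$. -/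

import Mathlib

open Metric Module
open scoped Manifold ContDiff

noncomputable section

namespace FiveSphere

/-! ### The sphere `S⁵ ⊂ ℂ³` and its round metric -/

/-- `ℂ³`, with the real inner product `⟪z, w⟫_ℝ = Re ∑ zⱼ conj wⱼ`. -/
abbrev C3 : Type := EuclideanSpace ℂ (Fin 3)

instance finrank_C3 : Fact (finrank ℝ C3 = 5 + 1) :=
  ⟨by rw [finrank_real_of_complex, finrank_euclideanSpace_fin]⟩

/-- The unit sphere of `ℂ³`, with Mathlib's smooth structure. -/
abbrev S5 : Type := sphere (0 : C3) 1

/-- The tangent space `T_p S⁵`. -/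
abbrev T (p : S5) : Type := TangentSpace (𝓡 5) p

/-- The differential at `p` of the inclusion `S⁵ → ℂ³`. -/
def incl (p : S5) : T p →L[ℝ] C3 := mvfderiv (𝓡 5) ((↑) : S5 → C3) p

/-- The canonical (round) Riemannian metric. -/
def g (p : S5) (x y : T p) : ℝ := inner ℝ (incl p x) (incl p y)

/-- The differential of the inclusion identifies `T_p S⁵` with `p^⊥ ⊂ ℂ³`. -/
def tangentEquiv (p : S5) : T p ≃ₗ[ℝ] (Submodule.span ℝ {(p : C3)})ᗮ :=
  LinearEquiv.ofBijective
    (LinearMap.codRestrict (Submodule.span ℝ {(p : C3)})ᗮ (incl p : T p →ₗ[ℝ] C3) fun x => by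
      have h := range_mvfderiv_subtypeVal (n := 5) p
      rw [← h]
      exact ⟨x, rfl⟩)
    ⟨fun x y h => injective_mvfderiv_subtypeVal_sphere (n := 5) p (congrArg Subtype.val h),
     fun v => by
      have hv : (v : C3) ∈ (mvfderiv (𝓡 5) ((↑) : S5 → C3) p).range := by
        rw [range_mvfderiv_subtypeVal (n := 5) p]
        exact v.2
      obtain ⟨x, hx⟩ := hv
      exact ⟨x, Subtype.ext hx⟩⟩

/-- The tangential component at `p` of a vector of `ℂ³`, as an element of `T_p S⁵`. -/
def tangentialPart (p : S5) : C3 →ₗ[ℝ] T p :=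
  (tangentEquiv p).symm.toLinearMap ∘ₗ
    ((Submodule.span ℝ {(p : C3)})ᗮ.orthogonalProjectionOnto : C3 →ₗ[ℝ] _)

/-! ### The Sasakian structure -/

/-- The Hopf vector field `ξ_z = -i z`. -/
def xi (p : S5) : T p := tangentialPart p (-(Complex.I • (p : C3)))

/-- `ψ(x)` is the tangential component of `i x`: `i x = ψ(x) + η(x) N` with `N_p = p`. -/
def psi (p : S5) (x : T p) : T p := tangentialPart p (Complex.I • incl p x)

/-- `η(x)` is the coefficient of the outward unit normal `N_p = p` in
`i x = ψ(x) + η(x) N`. -/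
def eta (p : S5) (x : T p) : ℝ := inner ℝ (Complex.I • incl p x) (p : C3)

/-- The Sasakian form `Φ(x, y) = g(x, ψ(y))`. -/
def Phi (p : S5) (x y : T p) : ℝ := g p x (psi p y)

/-! ### The almost contact structure coming from the nearly Kähler `S⁶` -/

/-- The imaginary octonions `∑ u_k e_k`; the index `k : Fin 7` stands for `e_k` when `k ≠ 0`
and the index `0` stands for `e₇` (indices modulo `7`). -/
abbrev ImO : Type := Fin 7 → ℝ

/-- The vector cross product `u × v = Im (u v)` of imaginary octonions.  The multiplication table
is `e_i e_{i+1} = e_{i+3}`, `e_{i+1} e_{i+3} = e_i`, `e_{i+3} e_i = e_{i+1}` (indices modulo `7`),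
with `e_i e_j = - e_j e_i` for `i ≠ j` and `e_i² = -1`. -/
def octCross (u v : ImO) : ImO := fun k =>
  (u (k - 3) * v (k - 2) - u (k - 2) * v (k - 3)) +
  (u (k + 1) * v (k + 3) - u (k + 3) * v (k + 1)) +
  (u (k + 2) * v (k - 1) - u (k - 1) * v (k + 2))

/-- `(z₁, z₂, z₃) ↦ z₁ e₁ + z₂ e₂ + z₃ e₄`, where `x + i y ∈ ℂ` is read as `x + y e₇`; recall
`e₇ e₁ = e₃`, `e₇ e₂ = e₆`, `e₇ e₄ = e₅`. -/
def toImO (z : C3) : ImO :=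
  ![0, (z 0).re, (z 1).re, (z 0).im, (z 2).re, (z 2).im, (z 1).im]

/-- The component of an imaginary octonion in `ℂ³ = {u | u₇ = 0}`, that is, its orthogonal
projection along `e₇`. -/
def ofImO (u : ImO) : C3 := !₂[(⟨u 1, u 3⟩ : ℂ), ⟨u 2, u 6⟩, ⟨u 4, u 5⟩]

/-- `ψ̂(x)` is the component tangent to `S⁵` of `J(x) = N × x`, for the totally geodesic
`S⁵ = S⁶ ∩ {u₇ = 0}` in `S⁶ ⊂ Im 𝕆` with unit normal `ν = -e₇`. -/
def psiHat (p : S5) (x : T p) : T p :=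
  tangentialPart p (ofImO (octCross (toImO (p : C3)) (toImO (incl p x))))

/-! ### Affine connections on `S⁵` -/

/-- Vector fields on `S⁵` (not necessarily smooth). -/
abbrev VF : Type := (p : S5) → T p

/-- A vector field is smooth if it is a smooth section of the tangent bundle. -/
def IsSmoothVF (X : VF) : Prop :=
  ContMDiff (𝓡 5) (𝓡 5).tangent ∞ (fun p => (⟨p, X p⟩ : TangentBundle (𝓡 5) S5))

/-- Covariant derivatives on the tangent bundle of `S⁵`; `(∇_X Y)_p` is `D Y p (X p)`.  What such
an object does on non-differentiable fields is irrelevant, see `SameConnection`. -/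
abbrev Conn : Type := CovariantDerivative (𝓡 5) (EuclideanSpace ℝ (Fin 5)) (fun p : S5 => T p)

/-- The vector field `∇_X Y`. -/
def nabla (D : Conn) (X Y : VF) : VF := fun p => D Y p (X p)

/-- `D` is an affine connection in the smooth category: `∇_X Y` is smooth for smooth `X`, `Y`. -/
def IsSmoothConn (D : Conn) : Prop := D.ContMDiffCovariantDerivative ∞

/-- `D` and `D'` are the same operator on smooth vector fields. -/
def SameConnection (D D' : Conn) : Prop :=
  ∀ X Y : VF, IsSmoothVF X → IsSmoothVF Y → nabla D X Y = nabla D' X Y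

/-- `∇ g = 0`. -/
def IsMetric (D : Conn) : Prop :=
  ∀ X Y Z : VF, IsSmoothVF X → IsSmoothVF Y → IsSmoothVF Z → ∀ p : S5,
    mvfderiv (𝓡 5) (fun q => g q (Y q) (Z q)) p (X p) =
      g p (nabla D X Y p) (Z p) + g p (Y p) (nabla D X Z p)

/-- `ω(x, y, z) = g(T(x, y), z)`, for `T` the torsion tensor
`T(X, Y) = ∇_X Y - ∇_Y X - [X, Y]`. -/
def torsionForm (D : Conn) (p : S5) (x y z : T p) : ℝ := g p (D.torsion p x y) z

/-- Totally skew-symmetric torsion: the trilinear `ω` is a `3`-form, i.e. it changes sign under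
the transpositions of neighbouring arguments. -/
def HasSkewTorsion (D : Conn) : Prop :=
  ∀ (p : S5) (x y z : T p),
    torsionForm D p y x z = - torsionForm D p x y z ∧
    torsionForm D p x z y = - torsionForm D p x y z

/-- The Levi-Civita connection of `g`: the metric connection without torsion. -/
def IsLeviCivita (D : Conn) : Prop :=
  IsSmoothConn D ∧ IsMetric D ∧ ∀ (p : S5) (x y : T p), D.torsion p x y = 0

/-! ### Invariance under `SU(3)` -/

lemma norm_toEuclideanLin (σ : Matrix.specialUnitaryGroup (Fin 3) ℂ) (v : C3) :
    ‖Matrix.toEuclideanLin (σ : Matrix (Fin 3) (Fin 3) ℂ) v‖ = ‖v‖ := by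
  have hU : (σ : Matrix (Fin 3) (Fin 3) ℂ) ∈ unitary (Matrix (Fin 3) (Fin 3) ℂ) :=
    (Matrix.mem_specialUnitaryGroup_iff.1 σ.2).1
  have h := Unitary.map_mem (Matrix.toEuclideanCLM (n := Fin 3) (𝕜 := ℂ)) hU
  exact Unitary.norm_map (𝕜 := ℂ) ⟨_, h⟩ v

/-- The action `τ_σ(p) = σ p` of `SU(3)` on `S⁵` by matrix multiplication. -/
def tau (σ : Matrix.specialUnitaryGroup (Fin 3) ℂ) (p : S5) : S5 :=
  ⟨Matrix.toEuclideanLin (σ : Matrix (Fin 3) (Fin 3) ℂ) (p : C3), by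
    rw [mem_sphere_zero_iff_norm, norm_toEuclideanLin]
    exact mem_sphere_zero_iff_norm.1 p.2⟩

/-- The vector field `τ_σ(X)_p = (τ_σ)_* (X_{σ⁻¹ p})`; equivalently, the pull-back of `X` under the
inverse diffeomorphism `τ_{σ⁻¹}`. -/
def push (σ : Matrix.specialUnitaryGroup (Fin 3) ℂ) (X : VF) : VF :=
  VectorField.mpullback (𝓡 5) (𝓡 5) (tau σ⁻¹) X

/-- `τ_σ(∇_X Y) = ∇_{τ_σ(X)} τ_σ(Y)` for all `σ ∈ SU(3)`. -/
def IsSU3Invariant (D : Conn) : Prop :=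
  ∀ (σ : Matrix.specialUnitaryGroup (Fin 3) ℂ) (X Y : VF), IsSmoothVF X → IsSmoothVF Y →
    push σ (nabla D X Y) = nabla D (push σ X) (push σ Y)

/-! ### Curvature -/

/-- `R(X, Y) Z = ∇_X ∇_Y Z - ∇_Y ∇_X Z - ∇_{[X, Y]} Z`. -/
def curvatureVF (D : Conn) (X Y Z : VF) : VF :=
  nabla D X (nabla D Y Z) - nabla D Y (nabla D X Z)
    - nabla D (VectorField.mlieBracket (𝓡 5) X Y) Z

/-- A smooth vector field with value `x` at `p`: the tangential part of the constant vector
field `x` on `ℂ³`. -/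
def extendVF {p : S5} (x : T p) : VF := fun q => tangentialPart q (incl p x)

/-- The curvature tensor at `p`, evaluated through smooth extensions of the tangent vectors (for
a smooth connection the result does not depend on the extensions). -/
def curvature (D : Conn) (p : S5) (x y z : T p) : T p :=
  curvatureVF D (extendVF x) (extendVF y) (extendVF z) p

/-- A basis of `T_p S⁵`. -/
def tangentBasis (p : S5) : Basis (Fin 5) ℝ (T p) :=
  (EuclideanSpace.basisFun (Fin 5) ℝ).toBasis

/-- The Ricci tensor `Ric(y, z) = tr (x ↦ R(x, y) z)`. -/
def ricci (D : Conn) (p : S5) (y z : T p) : ℝ :=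
  ∑ i, (tangentBasis p).repr (curvature D p (tangentBasis p i) y z) i

/-- The symmetric part of the Ricci tensor. -/
def symRicci (D : Conn) (p : S5) (x y : T p) : ℝ := (ricci D p x y + ricci D p y x) / 2

/-- The scalar curvature `s = ∑ g^{ij} Ric_{ij}`. -/
def scalarCurvature (D : Conn) (p : S5) : ℝ :=
  ((Matrix.of fun i j => g p (tangentBasis p i) (tangentBasis p j))⁻¹ *
    (Matrix.of fun i j => ricci D p (tangentBasis p i) (tangentBasis p j))).trace

/-- `(S⁵, g, ∇)` is `∇`-Einstein (Einstein with skew-torsion): `∇` is metric, has totally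
skew-symmetric torsion, and `Sym(Ric) = (s / dim) g`. -/
def IsNablaEinstein (D : Conn) : Prop :=
  IsMetric D ∧ HasSkewTorsion D ∧
    ∀ (p : S5) (x y : T p), symRicci D p x y = scalarCurvature D p / 5 * g p x y

/-! ### The three-parameter family -/

/-- The skew-symmetric tensor with parameters `r ∈ ℝ`, `q ∈ ℂ`. -/
def diffTensor (r : ℝ) (q : ℂ) (p : S5) (x y : T p) : T p :=
  r • (Phi p x y • xi p - eta p x • psi p y + eta p y • psi p x)
  + q.re • (eta p y • psi p (psiHat p x) - eta p x • psi p (psiHat p y)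
      + Phi p (psiHat p x) y • xi p)
  + q.im • (eta p x • psiHat p y - eta p y • psiHat p x + g p (psiHat p x) y • xi p)

/-- `∇` is given by the parameters `r`, `q`, i.e. `∇_X Y = ∇^g_X Y + diffTensor r q (X, Y)`. -/
def HasParameters (Dg D : Conn) (r : ℝ) (q : ℂ) : Prop :=
  ∀ X Y : VF, IsSmoothVF X → IsSmoothVF Y → ∀ p : S5,
    nabla D X Y p = nabla Dg X Y p + diffTensor r q p (X p) (Y p)

end FiveSphere

end

open FiveSphere

noncomputable section

namespace FiveSphere

open Filter Topology Bundle

/-! ### The sphere from outside -/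

/-! Everything is computed in `C3` through `incl`. There the Levi-Civita connection is `lc`, the
tangential part of the ambient derivative.

Classification. If `D` is metric with skew torsion, its difference `B` from `lc` makes `g(B(x, y),
z)` a 3-form (`diff_skew`, `diff_swap`). Since `lc` is natural under isometries, invariance of `D`
is invariance of this 3-form (`diffForm_su`). The group acts transitively (`exists_su_eq`), so the
form is determined at the point `(1, 0, 0)`, where it must be fixed by the stabilizer `SU(2)`. An
element of the stabilizer acting by `-1` on the complement of `ξ` kills the horizontal 3-forms. What
remains is `η ∧ β` with `β` an invariant 2-form on `ℂ²`, and such `β` have three real coefficients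
(`eq_zero_of_invariant`), which are matched by `r`, `Re q`, `Im q`. Conversely, every member of the
family is built from tensors equivariant under `SU(3)`.

Curvature. On the kernel of `η` the maps `ψ`, `ψ̂`, `ψψ̂` satisfy the quaternion relations, so the
parameters combine into one skew map `J` (`Jmap`) with `J² = -(r² + |q|²)` there, and the 3-form is
`η ∧ g(·, J ·)`. Expanding the curvature of `lc + B` and taking the trace, the round part gives
`4g`, the part quadratic in `B` gives the correction in `r² + |q|²`, and the derivative of `B`
contributes only a divergence that is skew in its two arguments (`HasParameters.ricci_eq`).
Symmetrizing removes it. With `c = r² + |q|²`, the symmetric Ricci tensor is `4 - 4c` on `ξ` and `4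
- 2c` on a unit vector orthogonal to `ξ`, so the Einstein condition forces `c = 0`. -/

lemma incl_injective (p : S5) : Function.Injective (incl p) :=
  injective_mvfderiv_subtypeVal_sphere (n := 5) p

lemma norm_coe (p : S5) : ‖(p : C3)‖ = 1 := mem_sphere_zero_iff_norm.1 p.2

lemma inner_coe_self (p : S5) : inner ℝ (p : C3) (p : C3) = 1 := by
  rw [real_inner_self_eq_norm_sq, norm_coe, one_pow]

lemma inner_coe_incl (p : S5) (x : T p) : inner ℝ (p : C3) (incl p x) = 0 := by
  have h : incl p x ∈ (Submodule.span ℝ {(p : C3)})ᗮ := (tangentEquiv p x).2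
  exact (Submodule.mem_orthogonal_singleton_iff_inner_right).1 h

lemma inner_incl_coe (p : S5) (x : T p) : inner ℝ (incl p x) (p : C3) = 0 := by
  rw [real_inner_comm, inner_coe_incl]

lemma coe_tangentEquiv (p : S5) (x : T p) : (tangentEquiv p x : C3) = incl p x := rfl

lemma incl_tangentialPart (p : S5) (v : C3) :
    incl p (tangentialPart p v) = v - inner ℝ (p : C3) v • (p : C3) := by
  have h : incl p (tangentialPart p v) =
      ((Submodule.span ℝ {(p : C3)})ᗮ.orthogonalProjectionOnto v : C3) := by
    rw [← coe_tangentEquiv]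
    exact congrArg Subtype.val ((tangentEquiv p).apply_symm_apply _)
  rw [h]
  have h2 := Submodule.starProjection_orthogonal_val (K := Submodule.span ℝ {(p : C3)}) v
  rw [Submodule.starProjection_unit_singleton ℝ (norm_coe p)] at h2
  exact h2

lemma incl_tangentialPart_of_inner_eq_zero (p : S5) {v : C3} (h : inner ℝ (p : C3) v = 0) :
    incl p (tangentialPart p v) = v := by
  rw [incl_tangentialPart, h, zero_smul, sub_zero]

@[simp] lemma tangentialPart_incl (p : S5) (x : T p) : tangentialPart p (incl p x) = x :=
  incl_injective p (incl_tangentialPart_of_inner_eq_zero p (inner_coe_incl p x))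

@[simp] lemma tangentialPart_coe (p : S5) : tangentialPart p (p : C3) = 0 := by
  apply incl_injective p
  rw [incl_tangentialPart, inner_coe_self, one_smul, sub_self, map_zero]

/-! ### Smoothness of vector fields, tested in `ℂ³`. -/

lemma contMDiff_coe : ContMDiff (𝓡 5) 𝓘(ℝ, C3) ∞ ((↑) : S5 → C3) :=
  contMDiff_coe_sphere

lemma mdifferentiableAt_coe (p : S5) : MDifferentiableAt (𝓡 5) 𝓘(ℝ, C3) ((↑) : S5 → C3) p :=
  (contMDiff_coe p).mdifferentiableAt (by simp)

/-- The stereographic chart at `p₀`, extended to an open subset of `ℂ³`. -/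
def chartExt (p₀ : S5) (v : C3) : EuclideanSpace ℝ (Fin 5) :=
  (OrthonormalBasis.fromOrthogonalSpanSingleton (𝕜 := ℝ) 5
    (ne_zero_of_mem_unit_sphere (-p₀))).repr (stereoToFun ((-p₀ : S5) : C3) v)

/-- The stereographic formula is singular where the inner product with the pole `-p₀` equals `1`; a
unit vector achieves this only at the pole. -/
lemma contDiffAt_chartExt (p₀ : S5) {p : S5} (h : (p : C3) ≠ -(p₀ : C3)) :
    ContDiffAt ℝ ω (chartExt p₀) (p : C3) := by
  have h1 : ContDiffAt ℝ ω (stereoToFun ((-p₀ : S5) : C3)) (p : C3) := by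
    refine (contDiffOn_stereoToFun (n := ω)).contDiffAt ?_
    refine IsOpen.mem_nhds (isOpen_ne_fun (by fun_prop) (by fun_prop)) ?_
    intro h2
    apply h
    have h3 : inner ℝ ((-p₀ : S5) : C3) (p : C3) = 1 := h2
    rw [inner_eq_one_iff_of_norm_eq_one (norm_coe _) (norm_coe _)] at h3
    exact h3.symm
  exact (LinearIsometryEquiv.contDiff _).contDiffAt.comp _ h1

/-- The trivialization at `p₀` is the derivative of the chart, and the chart is `chartExt p₀`
restricted to the sphere. The chain rule turns fibre coordinates into an ambient derivative, which
is visibly smooth in `p`. -/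
lemma trivializationAt_tangentialPart (p₀ : S5) {p : S5} (h : (p : C3) ≠ -(p₀ : C3)) (v : C3) :
    (trivializationAt (EuclideanSpace ℝ (Fin 5)) (fun p : S5 => T p) p₀
      ⟨p, tangentialPart p v⟩).2 =
      fderiv ℝ (chartExt p₀) (p : C3) (v - inner ℝ (p : C3) v • (p : C3)) := by
  have hs : p ∈ (chartAt (EuclideanSpace ℝ (Fin 5)) p₀).source := by
    show p ∈ (stereographic' 5 (-p₀)).source
    rw [stereographic'_source]
    intro h'
    exact h (congrArg Subtype.val h')
  have h1 := TangentBundle.continuousLinearMapAt_trivializationAt (I := 𝓡 5) hs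
  have h2 : (trivializationAt (EuclideanSpace ℝ (Fin 5)) (fun p : S5 => T p) p₀
      ⟨p, tangentialPart p v⟩).2 = (trivializationAt (EuclideanSpace ℝ (Fin 5))
        (TangentSpace (𝓡 5) : S5 → Type _) p₀).continuousLinearMapAt ℝ p (tangentialPart p v) := by
    rw [Trivialization.continuousLinearMapAt_apply, Trivialization.linearMapAt_apply, if_pos]
    simpa using hs
  rw [h2, h1, ← incl_tangentialPart]
  have h3 : MDifferentiableAt 𝓘(ℝ, C3) 𝓘(ℝ, EuclideanSpace ℝ (Fin 5)) (chartExt p₀) (p : C3) :=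
    ((contDiffAt_chartExt p₀ h).differentiableAt (by simp)).mdifferentiableAt
  have h4 := mfderiv_comp p h3 (mdifferentiableAt_coe p)
  have h5 : (chartExt p₀ ∘ ((↑) : S5 → C3)) = extChartAt (𝓡 5) p₀ := rfl
  rw [h5, mfderiv_eq_fderiv] at h4
  rw [h4]
  rfl

lemma ne_neg_eventually (p₀ : S5) : ∀ᶠ p : S5 in 𝓝 p₀, (p : C3) ≠ -(p₀ : C3) := by
  refine IsOpen.mem_nhds (isOpen_ne_fun (by fun_prop) (by fun_prop)) ?_
  intro h
  exact ne_neg_of_mem_unit_sphere ℝ p₀ (Subtype.ext h)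

/-- The tangential part of a smooth `ℂ³`-valued function is a smooth vector field. -/
lemma contMDiffAt_tangentialPart {v : S5 → C3} {p₀ : S5}
    (hv : ContMDiffAt (𝓡 5) 𝓘(ℝ, C3) ∞ v p₀) :
    ContMDiffAt (𝓡 5) (𝓡 5).tangent ∞
      (fun p => (⟨p, tangentialPart p (v p)⟩ : TangentBundle (𝓡 5) S5)) p₀ := by
  rw [contMDiffAt_section]
  have h0 := ne_neg_eventually p₀
  have hc : ContMDiffAt (𝓡 5) 𝓘(ℝ, C3) ∞ ((↑) : S5 → C3) p₀ := contMDiff_coe p₀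
  have hf : ContMDiffAt (𝓡 5) 𝓘(ℝ, C3 →L[ℝ] EuclideanSpace ℝ (Fin 5)) ∞
      (fun p : S5 => fderiv ℝ (chartExt p₀) (p : C3)) p₀ := by
    have h1 : ContDiffAt ℝ ∞ (fderiv ℝ (chartExt p₀)) (p₀ : C3) :=
      (contDiffAt_chartExt p₀ h0.self_of_nhds).fderiv_right (m := ∞) (by simp)
    exact h1.contMDiffAt.comp p₀ hc
  have hin : ContMDiffAt (𝓡 5) 𝓘(ℝ, ℝ) ∞ (fun p : S5 => inner ℝ (p : C3) (v p)) p₀ := by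
    have h1 : ContDiff ℝ ∞ (fun z : C3 × C3 => (inner ℝ z.1 z.2 : ℝ)) := contDiff_inner
    exact h1.contMDiff.contMDiffAt.comp p₀ (hc.prodMk_space hv)
  have hsub := hv.sub (hin.smul hc)
  refine (hf.clm_apply hsub).congr_of_eventuallyEq ?_
  filter_upwards [h0] with p hp
  exact trivializationAt_tangentialPart p₀ hp (v p)

lemma isSmoothVF_tangentialPart {v : S5 → C3} (hv : ContMDiff (𝓡 5) 𝓘(ℝ, C3) ∞ v) :
    IsSmoothVF (fun p => tangentialPart p (v p)) :=
  fun p => contMDiffAt_tangentialPart (hv p)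

/-- The derivative of a smooth function along a smooth vector field is smooth. -/
lemma contMDiffAt_mvfderiv_apply {F : Type*} [NormedAddCommGroup F] [NormedSpace ℝ F]
    {f : S5 → F} (hf : ContMDiff (𝓡 5) 𝓘(ℝ, F) ∞ f) {X : VF} {p₀ : S5}
    (hX : ContMDiffAt (𝓡 5) (𝓡 5).tangent ∞
      (fun p => (⟨p, X p⟩ : TangentBundle (𝓡 5) S5)) p₀) :
    ContMDiffAt (𝓡 5) 𝓘(ℝ, F) ∞ (fun p => mvfderiv (𝓡 5) f p (X p)) p₀ := by
  have h1 := hf.contMDiff_tangentMap (m := ∞) (by simp)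
  have h2 := (contMDiff_snd_tangentBundle_modelSpace F 𝓘(ℝ, F) (n := ∞))
  exact (h2.contMDiffAt.comp _ h1.contMDiffAt).comp p₀ hX

/-- A vector field, as a `ℂ³`-valued function. -/
def ext (X : VF) (p : S5) : C3 := incl p (X p)

lemma IsSmoothVF.contMDiff_ext {X : VF} (hX : IsSmoothVF X) : ContMDiff (𝓡 5) 𝓘(ℝ, C3) ∞ (ext X) :=
  fun p => contMDiffAt_mvfderiv_apply contMDiff_coe (hX p)

/-- The axioms of a covariant derivative concern fields differentiable at a single point, so `lc`
needs this pointwise form. -/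
lemma mdifferentiableAt_ext {X : VF} {p : S5}
    (hX : MDifferentiableAt (𝓡 5) (𝓡 5).tangent
      (fun p => (⟨p, X p⟩ : TangentBundle (𝓡 5) S5)) p) :
    MDifferentiableAt (𝓡 5) 𝓘(ℝ, C3) (ext X) p := by
  have h1 := contMDiff_coe.contMDiff_tangentMap (m := ∞) (by simp)
  have h2 := (contMDiff_snd_tangentBundle_modelSpace C3 𝓘(ℝ, C3) (n := ∞))
  have h3 := (h2.comp h1)
  exact (h3.mdifferentiable (by simp)).mdifferentiableAt.comp p hX

lemma isSmoothVF_of_contMDiff_ext {X : VF} (hX : ContMDiff (𝓡 5) 𝓘(ℝ, C3) ∞ (ext X)) :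
    IsSmoothVF X := by
  have h := isSmoothVF_tangentialPart hX
  simpa [ext] using h

lemma vf_ext {X Y : VF} (h : ∀ p, ext X p = ext Y p) : X = Y :=
  funext fun p => incl_injective p (h p)

lemma IsSmoothVF.mdifferentiableAt {X : VF} (hX : IsSmoothVF X) (p : S5) :
    MDifferentiableAt (𝓡 5) (𝓡 5).tangent
      (fun p => (⟨p, X p⟩ : TangentBundle (𝓡 5) S5)) p :=
  (hX p).mdifferentiableAt (by simp)

lemma ext_extendVF {p : S5} (x : T p) (q : S5) :
    ext (extendVF x) q = incl p x - inner ℝ (q : C3) (incl p x) • (q : C3) :=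
  incl_tangentialPart q _

lemma isSmoothVF_extendVF {p : S5} (x : T p) : IsSmoothVF (extendVF x) :=
  isSmoothVF_tangentialPart contMDiff_const

@[simp] lemma extendVF_self {p : S5} (x : T p) : extendVF x p = x := tangentialPart_incl p x

lemma mvfderiv_comp_coe {F : Type*} [NormedAddCommGroup F] [NormedSpace ℝ F] {f : C3 → F} {p : S5}
    (hf : DifferentiableAt ℝ f (p : C3)) (x : T p) :
    mvfderiv (𝓡 5) (fun q : S5 => f (q : C3)) p x = fderiv ℝ f (p : C3) (incl p x) := by
  have h := mfderiv_comp p hf.mdifferentiableAt (mdifferentiableAt_coe p)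
  rw [mfderiv_eq_fderiv] at h
  have h2 : mvfderiv (𝓡 5) (f ∘ ((↑) : S5 → C3)) p x = fderiv ℝ f (p : C3) (incl p x) := by
    unfold mvfderiv
    rw [h]
    rfl
  exact h2

lemma mvfderiv_inner {Y Z : S5 → C3} {p : S5} (hY : MDifferentiableAt (𝓡 5) 𝓘(ℝ, C3) Y p)
    (hZ : MDifferentiableAt (𝓡 5) 𝓘(ℝ, C3) Z p) (x : T p) :
    mvfderiv (𝓡 5) (fun q => inner ℝ (Y q) (Z q)) p x =
      inner ℝ (mvfderiv (𝓡 5) Y p x) (Z p) + inner ℝ (Y p) (mvfderiv (𝓡 5) Z p x) := by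
  have h1 : HasFDerivAt (fun z : C3 × C3 => (inner ℝ z.1 z.2 : ℝ))
      (fderivInnerCLM ℝ (Y p, Z p)) (Y p, Z p) := by
    have := (hasFDerivAt_fst (𝕜 := ℝ) (p := (Y p, Z p))).inner ℝ
      (hasFDerivAt_snd (𝕜 := ℝ) (p := (Y p, Z p)))
    exact this
  have h2 : HasMFDerivAt (𝓡 5) 𝓘(ℝ, C3 × C3) (fun q => (Y q, Z q)) p
      ((mvfderiv (𝓡 5) Y p).prod (mvfderiv (𝓡 5) Z p)) :=
    ⟨hY.continuousAt.prodMk hZ.continuousAt, hY.hasMFDerivAt.2.prodMk hZ.hasMFDerivAt.2⟩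
  have h3 := (h1.hasMFDerivAt.comp p h2).mfderiv
  have h4 : mvfderiv (𝓡 5) ((fun z : C3 × C3 => (inner ℝ z.1 z.2 : ℝ)) ∘ fun q => (Y q, Z q)) p x =
      fderivInnerCLM ℝ (Y p, Z p) (mvfderiv (𝓡 5) Y p x, mvfderiv (𝓡 5) Z p x) := by
    unfold mvfderiv
    rw [h3]
    rfl
  rw [fderivInnerCLM_apply] at h4
  rw [add_comm]
  exact h4

/-- Differentiate `⟨q, Y q⟩ = 0`: the normal part of the ambient derivative is the second
fundamental form. -/
lemma inner_coe_mvfderiv_ext {Y : VF} {p : S5}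
    (hY : MDifferentiableAt (𝓡 5) 𝓘(ℝ, C3) (ext Y) p) (x : T p) :
    inner ℝ (p : C3) (mvfderiv (𝓡 5) (ext Y) p x) = - inner ℝ (incl p x) (ext Y p) := by
  have h := mvfderiv_inner (mdifferentiableAt_coe p) hY x
  have h0 : (fun q : S5 => (inner ℝ (q : C3) (ext Y q) : ℝ)) = fun _ => 0 :=
    funext fun q => inner_coe_incl q (Y q)
  rw [h0, mvfderiv_const] at h
  have h' : (0 : ℝ) = inner ℝ (incl p x) (ext Y p) +
    inner ℝ (p : C3) (mvfderiv (𝓡 5) (ext Y) p x) := h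
  linarith

/-! ### The Levi-Civita connection -/

/-- The Levi-Civita connection: the tangential part of the derivative in `ℂ³`. -/
def lc : Conn where
  toFun Y p := (LinearMap.toContinuousLinearMap (tangentialPart p)).comp (mvfderiv (𝓡 5) (ext Y) p)
  isCovariantDerivativeOnUniv :=
    { add := by
        intro Y Z p hY hZ _
        have h : ext (Y + Z) = ext Y + ext Z := funext fun q => map_add (incl q) _ _
        rw [h, mvfderiv_add (mdifferentiableAt_ext hY) (mdifferentiableAt_ext hZ),
          ContinuousLinearMap.comp_add]
      leibniz := by
        intro Y f p hY hf _
        have h : ext (f • Y) = f • ext Y := funext fun q => map_smul (incl q) _ _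
        rw [h, mvfderiv_smul hf (mdifferentiableAt_ext hY)]
        ext1 x
        simp only [ContinuousLinearMap.comp_apply, _root_.add_apply,
          _root_.smul_apply, ContinuousLinearMap.smulRight_apply,
          LinearMap.coe_toContinuousLinearMap', map_add, map_smul]
        rw [show tangentialPart p (ext Y p) = Y p from tangentialPart_incl p _] }

lemma lc_apply (Y : VF) (p : S5) (x : T p) :
    lc Y p x = tangentialPart p (mvfderiv (𝓡 5) (ext Y) p x) := rfl

lemma incl_lc {Y : VF} {p : S5} (hY : MDifferentiableAt (𝓡 5) 𝓘(ℝ, C3) (ext Y) p) (x : T p) :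
    incl p (lc Y p x) =
      mvfderiv (𝓡 5) (ext Y) p x + inner ℝ (incl p x) (ext Y p) • (p : C3) := by
  rw [lc_apply, incl_tangentialPart, inner_coe_mvfderiv_ext hY]
  module

lemma lc_isMetric : IsMetric lc := by
  intro X Y Z _ hY hZ p
  have hY' := mdifferentiableAt_ext (hY.mdifferentiableAt p)
  have hZ' := mdifferentiableAt_ext (hZ.mdifferentiableAt p)
  have h := mvfderiv_inner hY' hZ' (X p)
  refine h.trans ?_
  unfold g nabla
  rw [incl_lc hY', incl_lc hZ', inner_add_left, inner_add_right, real_inner_smul_left,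
    real_inner_smul_right, inner_coe_incl, inner_incl_coe]
  simp [ext]

/-- Smoothness of a section of `Hom(TS⁵, TS⁵)` can be tested on smooth vector fields. -/
lemma contMDiffAt_hom {A : (p : S5) → T p →L[ℝ] T p} {p₀ : S5}
    (h : ∀ X : VF, ContMDiffAt (𝓡 5) (𝓡 5).tangent ∞
        (fun p => (⟨p, X p⟩ : TangentBundle (𝓡 5) S5)) p₀ →
      ContMDiffAt (𝓡 5) (𝓡 5).tangent ∞
        (fun p => (⟨p, A p (X p)⟩ : TangentBundle (𝓡 5) S5)) p₀) :
    ContMDiffAt (𝓡 5) ((𝓡 5).prod 𝓘(ℝ, EuclideanSpace ℝ (Fin 5) →L[ℝ] EuclideanSpace ℝ (Fin 5))) ∞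
      (fun p => (⟨p, A p⟩ : TotalSpace (EuclideanSpace ℝ (Fin 5) →L[ℝ] EuclideanSpace ℝ (Fin 5))
        fun p : S5 => T p →L[ℝ] T p)) p₀ := by
  rw [contMDiffAt_hom_bundle]
  refine ⟨contMDiffAt_id, ?_⟩
  let e := trivializationAt (EuclideanSpace ℝ (Fin 5)) (TangentSpace (𝓡 5) : S5 → Type _) p₀
  have hp₀ : p₀ ∈ e.baseSet := FiberBundle.mem_baseSet_trivializationAt _ _ p₀
  have key : ∀ v : EuclideanSpace ℝ (Fin 5), ContMDiffAt (𝓡 5) 𝓘(ℝ, EuclideanSpace ℝ (Fin 5)) ∞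
      (fun p => ContinuousLinearMap.inCoordinates (EuclideanSpace ℝ (Fin 5))
        (TangentSpace (𝓡 5) : S5 → Type _) (EuclideanSpace ℝ (Fin 5))
        (TangentSpace (𝓡 5) : S5 → Type _) p₀ p p₀ p (A p) v) p₀ := by
    intro v
    -- The test fields are those with constant coordinate `v` in the trivialization near `p₀`.
    have hX : ContMDiffAt (𝓡 5) (𝓡 5).tangent ∞
        (fun p => (⟨p, e.symmL ℝ p v⟩ : TangentBundle (𝓡 5) S5)) p₀ := by
      rw [e.contMDiffAt_section_iff hp₀]
      refine (contMDiffAt_const (c := v)).congr_of_eventuallyEq ?_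
      filter_upwards [e.open_baseSet.mem_nhds hp₀] with p hp
      rw [e.symmL_apply hp, e.mk_symm hp]
      simp [e.apply_symm_apply' hp]
    have h2 := h _ hX
    rw [e.contMDiffAt_section_iff hp₀] at h2
    refine h2.congr_of_eventuallyEq ?_
    filter_upwards [e.open_baseSet.mem_nhds hp₀] with p hp
    rw [ContinuousLinearMap.inCoordinates]
    simp only [ContinuousLinearMap.comp_apply]
    rw [Trivialization.continuousLinearMapAt_apply, Trivialization.linearMapAt_apply, if_pos hp]
  let b := EuclideanSpace.basisFun (Fin 5) ℝ
  -- An operator on a finite-dimensional space is a smooth function of its values on a basis.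
  have hsum : ∀ L : EuclideanSpace ℝ (Fin 5) →L[ℝ] EuclideanSpace ℝ (Fin 5),
      L = ∑ i, ContinuousLinearMap.smulRightL ℝ _ _
        (EuclideanSpace.proj (𝕜 := ℝ) i) (L (b i)) := by
    intro L
    ext1 v
    conv_lhs => rw [← b.sum_repr v, map_sum]
    simp [b, _root_.sum_apply]
  have hs : ContMDiffAt (𝓡 5)
      𝓘(ℝ, EuclideanSpace ℝ (Fin 5) →L[ℝ] EuclideanSpace ℝ (Fin 5)) ∞
      (fun p => ∑ i, ContinuousLinearMap.smulRightL ℝ _ _ (EuclideanSpace.proj (𝕜 := ℝ) i)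
        (ContinuousLinearMap.inCoordinates (EuclideanSpace ℝ (Fin 5))
        (TangentSpace (𝓡 5) : S5 → Type _) (EuclideanSpace ℝ (Fin 5))
        (TangentSpace (𝓡 5) : S5 → Type _) p₀ p p₀ p (A p) (b i))) p₀ :=
    contMDiffAt_finsetSum fun i _ =>
      (ContinuousLinearMap.contMDiff _).contMDiffAt.comp p₀ (key (b i))
  exact hs.congr_of_eventuallyEq (Eventually.of_forall fun p => hsum _)

lemma lc_isSmoothConn : IsSmoothConn lc where
  contMDiff := ⟨by
    intro Y hY p _
    have hY' : IsSmoothVF Y := contMDiffOn_univ.1 hY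
    refine ContMDiffAt.contMDiffWithinAt (contMDiffAt_hom fun X hX => ?_)
    exact contMDiffAt_tangentialPart (contMDiffAt_mvfderiv_apply hY'.contMDiff_ext hX)⟩

lemma IsSmoothConn.isSmoothVF {D : Conn} (hD : IsSmoothConn D) {X Y : VF} (hX : IsSmoothVF X)
    (hY : IsSmoothVF Y) : IsSmoothVF (nabla D X Y) := by
  have h := contMDiffOn_univ.1 (hD.contMDiff.contMDiff (contMDiffOn_univ.2 hY))
  exact h.clm_bundle_apply hX

/-! ### The fields `extendVF x` -/

lemma mvfderiv_ext_extendVF {p : S5} (x : T p) (q : S5) (v : T q) :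
    mvfderiv (𝓡 5) (ext (extendVF x)) q v =
      -(inner ℝ (incl q v) (incl p x) • (q : C3) + inner ℝ (q : C3) (incl p x) • incl q v) := by
  have h0 : ext (extendVF x) =
      fun q : S5 => (fun z : C3 => incl p x - inner ℝ z (incl p x) • z) (q : C3) :=
    funext (ext_extendVF x)
  have h1 : HasFDerivAt (fun z : C3 => (inner ℝ z (incl p x) : ℝ))
      ((innerSL ℝ).flip (incl p x)) (q : C3) :=
    ((innerSL ℝ).flip (incl p x)).hasFDerivAt
  have h2 : HasFDerivAt (fun z : C3 => incl p x - inner ℝ z (incl p x) • z) _ (q : C3) :=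
    (h1.smul (hasFDerivAt_id (𝕜 := ℝ) (q : C3))).const_sub (incl p x)
  rw [h0, mvfderiv_comp_coe h2.differentiableAt]
  rw [h2.fderiv]
  simp only [_root_.neg_apply, _root_.add_apply, _root_.smul_apply, ContinuousLinearMap.smulRight_apply,
    ContinuousLinearMap.flip_apply, innerSL_apply_apply, ContinuousLinearMap.id_apply, id]
  abel

/-- `extendVF z` is the gradient of the height function `⟨·, z⟩` on the sphere, with Hessian `-⟨·,
z⟩ g`. As `z ⊥ p`, the extension is parallel at `p`, which simplifies all later curvature
computations. -/
lemma nabla_lc_extendVF {p : S5} (z : T p) (q : S5) (v : T q) :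
    lc (extendVF z) q v = -(inner ℝ (q : C3) (incl p z) • v) := by
  apply incl_injective q
  rw [incl_lc (mdifferentiableAt_ext ((isSmoothVF_extendVF z).mdifferentiableAt q)),
    mvfderiv_ext_extendVF, ext_extendVF, inner_sub_right, real_inner_smul_right, inner_incl_coe,
    map_neg, map_smul]
  module

/-! ### Linear isometries -/

/-- The action of a linear isometry of `ℂ³ = ℝ⁶` on the sphere. -/
def isoAct (L : C3 ≃ₗᵢ[ℝ] C3) (p : S5) : S5 :=
  ⟨L p, by rw [mem_sphere_zero_iff_norm, L.norm_map, norm_coe]⟩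

@[simp] lemma coe_isoAct (L : C3 ≃ₗᵢ[ℝ] C3) (p : S5) : (isoAct L p : C3) = L p := rfl

lemma contMDiff_isoAct (L : C3 ≃ₗᵢ[ℝ] C3) : ContMDiff (𝓡 5) (𝓡 5) ∞ (isoAct L) :=
  ContMDiff.codRestrict_sphere (L.contDiff.contMDiff.comp contMDiff_coe) _

lemma mdifferentiableAt_isoAct (L : C3 ≃ₗᵢ[ℝ] C3) (p : S5) :
    MDifferentiableAt (𝓡 5) (𝓡 5) (isoAct L) p :=
  (contMDiff_isoAct L p).mdifferentiableAt (by simp)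

lemma incl_mfderiv_isoAct (L : C3 ≃ₗᵢ[ℝ] C3) (p : S5) (x : T p) :
    incl (isoAct L p) (mfderiv (𝓡 5) (𝓡 5) (isoAct L) p x) = L (incl p x) := by
  have h := mfderiv_comp_apply p (mdifferentiableAt_coe (isoAct L p)) (mdifferentiableAt_isoAct L p)
    x
  have h2 := mvfderiv_comp_coe (f := fun v : C3 => L v) (p := p) (L.differentiable _) x
  have h3 : fderiv ℝ (fun v : C3 => L v) (p : C3) = (L : C3 →L[ℝ] C3) :=
    L.toContinuousLinearEquiv.toContinuousLinearMap.fderiv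
  rw [h3] at h2
  exact h.symm.trans h2

/-- `mpullback` uses `ContinuousLinearMap.inverse`, which is zero on non-invertible maps, so an
explicit two-sided inverse is exhibited. -/
lemma mfderiv_isoAct_inverse (L : C3 ≃ₗᵢ[ℝ] C3) (p : S5) (x : T (isoAct L p)) :
    incl p ((mfderiv (𝓡 5) (𝓡 5) (isoAct L) p).inverse x) = L.symm (incl (isoAct L p) x) := by
  have hperp (y : T (isoAct L p)) : inner ℝ (p : C3) (L.symm (incl (isoAct L p) y)) = 0 := by
    rw [← L.inner_map_map, L.apply_symm_apply, ← coe_isoAct, inner_coe_incl]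
  let G : T (isoAct L p) →L[ℝ] T p := (LinearMap.toContinuousLinearMap (tangentialPart p)).comp
    ((L.symm : C3 →L[ℝ] C3).comp (incl (isoAct L p)))
  have hG (y : T (isoAct L p)) : incl p (G y) = L.symm (incl (isoAct L p) y) :=
    incl_tangentialPart_of_inner_eq_zero p (hperp y)
  have h : (mfderiv (𝓡 5) (𝓡 5) (isoAct L) p).inverse = G := by
    apply ContinuousLinearMap.inverse_eq
    · ext1 y
      apply incl_injective (isoAct L p)
      simp only [ContinuousLinearMap.comp_apply, ContinuousLinearMap.id_apply]
      rw [incl_mfderiv_isoAct, hG, L.apply_symm_apply]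
    · ext1 y
      apply incl_injective p
      simp only [ContinuousLinearMap.comp_apply, ContinuousLinearMap.id_apply]
      rw [hG, incl_mfderiv_isoAct, L.symm_apply_apply]
  rw [h, hG]

lemma ext_mpullback_isoAct (L : C3 ≃ₗᵢ[ℝ] C3) (X : VF) (p : S5) :
    ext (VectorField.mpullback (𝓡 5) (𝓡 5) (isoAct L) X) p = L.symm (ext X (isoAct L p)) :=
  mfderiv_isoAct_inverse L p _

lemma IsSmoothVF.mpullback_isoAct (L : C3 ≃ₗᵢ[ℝ] C3) {X : VF} (hX : IsSmoothVF X) :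
    IsSmoothVF (VectorField.mpullback (𝓡 5) (𝓡 5) (isoAct L) X) := by
  apply isSmoothVF_of_contMDiff_ext
  have h : ext (VectorField.mpullback (𝓡 5) (𝓡 5) (isoAct L) X) =
      fun p => L.symm (ext X (isoAct L p)) := funext (ext_mpullback_isoAct L X)
  rw [h]
  exact L.symm.contDiff.contMDiff.comp (hX.contMDiff_ext.comp (contMDiff_isoAct L))

lemma mvfderiv_ext_mpullback (L : C3 ≃ₗᵢ[ℝ] C3) {X : VF} (hX : IsSmoothVF X) (p : S5) (v : T p) :
    mvfderiv (𝓡 5) (ext (VectorField.mpullback (𝓡 5) (𝓡 5) (isoAct L) X)) p v =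
      L.symm (mvfderiv (𝓡 5) (ext X) (isoAct L p) (mfderiv (𝓡 5) (𝓡 5) (isoAct L) p v)) := by
  have h : ext (VectorField.mpullback (𝓡 5) (𝓡 5) (isoAct L) X) =
      (fun v : C3 => L.symm v) ∘ ext X ∘ isoAct L := funext (ext_mpullback_isoAct L X)
  rw [h]
  have h1 := mdifferentiableAt_ext (hX.mdifferentiableAt (isoAct L p))
  have h2 := h1.comp p (mdifferentiableAt_isoAct L p)
  have h3 : MDifferentiableAt 𝓘(ℝ, C3) 𝓘(ℝ, C3) (fun v : C3 => L.symm v) (ext X (isoAct L p)) :=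
    (L.symm.differentiable _).mdifferentiableAt
  have h4 := mfderiv_comp_apply p h3 h2 v
  rw [mfderiv_comp_apply p h1 (mdifferentiableAt_isoAct L p) v, mfderiv_eq_fderiv] at h4
  have h5 : fderiv ℝ (fun v : C3 => L.symm v) ((ext X ∘ isoAct L) p) = (L.symm : C3 →L[ℝ] C3) :=
    L.symm.toContinuousLinearEquiv.toContinuousLinearMap.fderiv
  exact h4.trans (congrArg (fun A : C3 →L[ℝ] C3 => A _) h5)

/-- The Levi-Civita connection is natural under linear isometries. -/
lemma mpullback_nabla_lc (L : C3 ≃ₗᵢ[ℝ] C3) {X Y : VF} (hY : IsSmoothVF Y) :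
    VectorField.mpullback (𝓡 5) (𝓡 5) (isoAct L) (nabla lc X Y) =
      nabla lc (VectorField.mpullback (𝓡 5) (𝓡 5) (isoAct L) X)
        (VectorField.mpullback (𝓡 5) (𝓡 5) (isoAct L) Y) := by
  apply vf_ext
  intro p
  rw [ext_mpullback_isoAct]
  have hX' := ext_mpullback_isoAct L X p
  have hY' := ext_mpullback_isoAct L Y p
  have h1 : mfderiv (𝓡 5) (𝓡 5) (isoAct L) p
      (VectorField.mpullback (𝓡 5) (𝓡 5) (isoAct L) X p) = X (isoAct L p) := by
    apply incl_injective (isoAct L p)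
    rw [incl_mfderiv_isoAct]
    exact (congrArg L hX').trans (L.apply_symm_apply _)
  show L.symm (incl (isoAct L p) (lc Y (isoAct L p) (X (isoAct L p)))) = incl p (lc _ p _)
  rw [incl_lc (mdifferentiableAt_ext (hY.mdifferentiableAt _)),
    incl_lc (mdifferentiableAt_ext ((hY.mpullback_isoAct L).mdifferentiableAt _)),
    mvfderiv_ext_mpullback L hY, h1, hY']
  rw [show incl p (VectorField.mpullback (𝓡 5) (𝓡 5) (isoAct L) X p) = _ from hX',
    L.symm.inner_map_map, map_add, map_smul, coe_isoAct, L.symm_apply_apply]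
  rfl

/-- The fields `extendVF x` and `extendVF y` commute at the base point: both are reversed by the
reflection in the line through the base point. -/
lemma mlieBracket_extendVF {p : S5} (x y : T p) :
    VectorField.mlieBracket (𝓡 5) (extendVF x) (extendVF y) p = 0 := by
  let K := Submodule.span ℝ {(p : C3)}
  let L : C3 ≃ₗᵢ[ℝ] C3 := K.reflection
  have hLp : L (p : C3) = p := K.reflection_mem_subspace_eq_self (Submodule.mem_span_singleton_self _)
  have hp : isoAct L p = p := Subtype.ext hLp
  have hLs : L.symm = L := K.reflection_symm
  have hLx (x : T p) : L (incl p x) = -incl p x :=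
    K.reflection_mem_subspace_orthogonalComplement_eq_neg
      (Submodule.mem_orthogonal_singleton_iff_inner_right.2 (inner_coe_incl p x))
  have hpull (x : T p) :
      VectorField.mpullback (𝓡 5) (𝓡 5) (isoAct L) (extendVF x) = -extendVF x := by
    apply vf_ext
    intro q
    rw [ext_mpullback_isoAct, ext_extendVF, map_sub, map_smul, hLs, hLx, coe_isoAct]
    have h1 : L (L (q : C3)) = q := by
      conv_lhs => rw [← hLs]
      exact K.reflection_reflection q
    have h2 : inner ℝ (L (q : C3)) (incl p x) = -inner ℝ (q : C3) (incl p x) := by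
      rw [← L.inner_map_map, h1, hLx, inner_neg_right]
    have h3 : ext (-extendVF x) q = -ext (extendVF x) q := map_neg (incl q) _
    rw [h1, h2, h3, ext_extendVF]
    module
  have h := VectorField.mpullback_mlieBracket (I := 𝓡 5) (I' := 𝓡 5) (n := 2) (f := isoAct L)
    (x₀ := p)
    ((isSmoothVF_extendVF x).mdifferentiableAt _) ((isSmoothVF_extendVF y).mdifferentiableAt _)
    ((contMDiff_isoAct L p).of_le (by norm_cast))
    (by simp)
  rw [hpull, hpull] at h
  -- The bracket is bilinear, so the two signs cancel; but `L` acts by `-1` on the tangent space at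
  -- `p`, so the bracket there equals its own negative.
  have hneg : VectorField.mlieBracket (𝓡 5) (-extendVF x) (-extendVF y) p =
      VectorField.mlieBracket (𝓡 5) (extendVF x) (extendVF y) p := by
    have hx := (isSmoothVF_extendVF x).mdifferentiableAt p
    have hy := (isSmoothVF_extendVF y).mdifferentiableAt p
    rw [← neg_one_smul ℝ (extendVF x), ← neg_one_smul ℝ (extendVF y),
      VectorField.mlieBracket_const_smul_right, VectorField.mlieBracket_const_smul_left hx]
    · module
    · exact hy
  rw [hneg] at h
  have h1 := congrArg (incl p) h
  have h2 := ext_mpullback_isoAct L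
    (VectorField.mlieBracket (𝓡 5) (extendVF x) (extendVF y)) p
  have h3 : ext (VectorField.mlieBracket (𝓡 5) (extendVF x) (extendVF y)) (isoAct L p) =
      incl p (VectorField.mlieBracket (𝓡 5) (extendVF x) (extendVF y) p) := by
    rw [hp]; rfl
  rw [h3, hLs, hLx] at h2
  apply incl_injective p
  have h4 : incl p (VectorField.mlieBracket (𝓡 5) (extendVF x) (extendVF y) p) =
     - incl p (VectorField.mlieBracket (𝓡 5) (extendVF x) (extendVF y) p) := h1.symm.trans h2
  rw [map_zero]
  rw [eq_neg_iff_add_eq_zero, ← two_smul ℝ] at h4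
  exact (smul_eq_zero.1 h4).resolve_left two_ne_zero

lemma torsion_eq (D : Conn) {X Y : VF} (hX : IsSmoothVF X) (hY : IsSmoothVF Y) (p : S5) :
    D.torsion p (X p) (Y p) =
      nabla D X Y p - nabla D Y X p - VectorField.mlieBracket (𝓡 5) X Y p :=
  D.torsion_apply (hX.mdifferentiableAt p) (hY.mdifferentiableAt p)

lemma lc_torsion (p : S5) (x y : T p) : lc.torsion p x y = 0 := by
  have h := torsion_eq lc (isSmoothVF_extendVF x) (isSmoothVF_extendVF y) p
  rw [extendVF_self, extendVF_self, mlieBracket_extendVF] at h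
  rw [h]
  simp [nabla, nabla_lc_extendVF, inner_coe_incl]

theorem lc_isLeviCivita : IsLeviCivita lc := ⟨lc_isSmoothConn, lc_isMetric, lc_torsion⟩

/-! ### The difference of two connections -/

/-- The difference tensor: `∇_X Y - ∇'_X Y = diff D D' (X, Y)`. -/
def diff (D D' : Conn) (p : S5) : T p →ₗ[ℝ] T p →ₗ[ℝ] T p :=
  LinearMap.mk₂ ℝ (fun x y => D.difference D' p y x)
    (fun _ _ _ => map_add _ _ _) (fun _ _ _ => map_smul _ _ _)
    (fun x y y' => by rw [map_add, _root_.add_apply])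
    (fun c x y => by rw [map_smul, _root_.smul_apply])

lemma diff_apply (D D' : Conn) {X Y : VF} (hY : IsSmoothVF Y) (p : S5) :
    diff D D' p (X p) (Y p) = nabla D X Y p - nabla D' X Y p := by
  have h := IsCovariantDerivativeOn.difference_apply D.isCovariantDerivativeOnUniv
    D'.isCovariantDerivativeOnUniv (x := p) trivial (hY.mdifferentiableAt p)
  exact congrArg (fun A : T p →L[ℝ] T p => A (X p)) h

lemma diff_eq_extendVF (D D' : Conn) {p : S5} (x y : T p) :
    diff D D' p x y = nabla D (extendVF x) (extendVF y) p -
      nabla D' (extendVF x) (extendVF y) p := by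
  rw [← diff_apply D D' (isSmoothVF_extendVF y), extendVF_self, extendVF_self]

lemma g_add_left (p : S5) (x y z : T p) : g p (x + y) z = g p x z + g p y z := by
  simp only [g, map_add, inner_add_left]

lemma g_add_right (p : S5) (x y z : T p) : g p x (y + z) = g p x y + g p x z := by
  simp only [g, map_add, inner_add_right]

lemma g_sub_left (p : S5) (x y z : T p) : g p (x - y) z = g p x z - g p y z := by
  simp only [g, map_sub, inner_sub_left]

lemma g_sub_right (p : S5) (x y z : T p) : g p x (y - z) = g p x y - g p x z := by
  simp only [g, map_sub, inner_sub_right]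

lemma g_smul_left (p : S5) (a : ℝ) (x y : T p) : g p (a • x) y = a * g p x y := by
  simp only [g, map_smul, real_inner_smul_left]

lemma g_smul_right (p : S5) (a : ℝ) (x y : T p) : g p x (a • y) = a * g p x y := by
  simp only [g, map_smul, real_inner_smul_right]

lemma g_neg_left (p : S5) (x y : T p) : g p (-x) y = -g p x y := by
  simp only [g, map_neg, inner_neg_left]

lemma g_neg_right (p : S5) (x y : T p) : g p x (-y) = -g p x y := by
  simp only [g, map_neg, inner_neg_right]

lemma g_zero_left (p : S5) (x : T p) : g p 0 x = 0 := by simp only [g, map_zero, inner_zero_left]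

lemma g_comm (p : S5) (x y : T p) : g p x y = g p y x := real_inner_comm _ _

lemma eq_of_g_eq {p : S5} {x y : T p} (h : ∀ z, g p x z = g p y z) : x = y := by
  apply incl_injective p
  rw [← sub_eq_zero, ← inner_self_eq_zero (𝕜 := ℝ)]
  have h1 := h (x - y)
  rw [← sub_eq_zero, ← g_sub_left] at h1
  simpa only [g, map_sub] using h1

/-- Both connections compute the derivative of the same function `g(Y, Z)`; subtract the two
formulas. -/
lemma diff_skew {D D' : Conn} (hD : IsMetric D) (hD' : IsMetric D') (p : S5) (x y z : T p) :
    g p (diff D D' p x y) z = - g p y (diff D D' p x z) := by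
  have hx := isSmoothVF_extendVF x
  have hy := isSmoothVF_extendVF y
  have hz := isSmoothVF_extendVF z
  have h := (hD _ _ _ hx hy hz p).symm.trans (hD' _ _ _ hx hy hz p)
  rw [extendVF_self, extendVF_self] at h
  rw [diff_eq_extendVF, diff_eq_extendVF, g_sub_left, g_sub_right]
  linarith

lemma diff_sub_diff_swap (D D' : Conn) (p : S5) (x y : T p) :
    diff D D' p x y - diff D D' p y x = D.torsion p x y - D'.torsion p x y := by
  have hx := isSmoothVF_extendVF x
  have hy := isSmoothVF_extendVF y
  have h := torsion_eq D hx hy p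
  have h' := torsion_eq D' hx hy p
  rw [extendVF_self, extendVF_self] at h h'
  rw [h, h', diff_eq_extendVF, diff_eq_extendVF]
  abel

/-- If `D'` is metric and torsion free, and `D` is metric with skew torsion, then the
difference tensor is a `3`-form. -/
lemma diff_swap {D D' : Conn} (hD : IsMetric D) (hs : HasSkewTorsion D) (hD' : IsLeviCivita D')
    (p : S5) (x y : T p) : diff D D' p x y = - diff D D' p y x := by
  set B := diff D D' p with hB
  have hskew := diff_skew hD hD'.2.1 p
  rw [← hB] at hskew
  have ht : ∀ x y, B x y - B y x = D.torsion p x y := by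
    intro x y
    rw [hB, diff_sub_diff_swap, hD'.2.2, sub_zero]
  have h1 : ∀ x y z, g p (B x y) z - g p (B y x) z = torsionForm D p x y z := by
    intro x y z
    rw [← g_sub_left, ht]; rfl
  apply eq_of_g_eq
  intro z
  rw [g_neg_left]
  -- Write `b(x, y, z) = g(B(x, y), z)`, skew in `y, z`. In the sum of `e2` and `e3` the torsion
  -- terms and `b(z, x, y)` cancel, leaving `b(x, y, z) + b(y, x, z) = 0`.
  have e1 := h1 x y z
  have e2 := h1 x z y
  have e3 := h1 y z x
  have s1 := (hs p x y z).2
  have s2 := (hs p y x z).1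
  have s3 := (hs p y x z).2
  have k1 := hskew x y z
  have k2 := hskew y x z
  have k3 := hskew z x y
  rw [g_comm p y] at k1
  rw [g_comm p x] at k2 k3
  linarith

/-- Two Levi-Civita connections agree. -/
lemma diff_eq_zero_of_isLeviCivita {D D' : Conn} (hD : IsLeviCivita D) (hD' : IsLeviCivita D')
    (p : S5) (x y : T p) : diff D D' p x y = 0 := by
  have hs : HasSkewTorsion D := fun p x y z => by
    simp only [torsionForm, hD.2.2, g_zero_left, neg_zero, and_self]
  -- Zero torsion is skew, so the difference is alternating; equal torsions make it symmetric as
  -- well.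
  have h1 := diff_swap hD.2.1 hs hD' p x y
  have h2 := diff_sub_diff_swap D D' p x y
  rw [hD.2.2, hD'.2.2, sub_zero, sub_eq_zero] at h2
  rw [← h2, eq_neg_iff_add_eq_zero, ← two_smul ℝ] at h1
  exact (smul_eq_zero.1 h1).resolve_left two_ne_zero

lemma IsLeviCivita.nabla_eq {D : Conn} (hD : IsLeviCivita D) {X Y : VF} (hY : IsSmoothVF Y) :
    nabla D X Y = nabla lc X Y := by
  funext p
  have h := diff_apply D lc (X := X) hY p
  rwa [diff_eq_zero_of_isLeviCivita hD lc_isLeviCivita, eq_comm, sub_eq_zero] at h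

/-! ### Algebra in `ℂ³` -/

lemma inner_C3 (z w : C3) : inner ℝ z w =
    (z 0).re * (w 0).re + (z 0).im * (w 0).im + ((z 1).re * (w 1).re + (z 1).im * (w 1).im)
      + ((z 2).re * (w 2).re + (z 2).im * (w 2).im) := by
  rw [PiLp.inner_apply, Fin.sum_univ_three]
  simp only [Complex.inner, Complex.mul_re, Complex.conj_re, Complex.conj_im]
  ring

/-- The conjugate of the complex cross product of `p` and `u`. -/
def hcross (p u : C3) : C3 :=
  !₂[(starRingEnd ℂ) (p 1 * u 2 - p 2 * u 1), (starRingEnd ℂ) (p 2 * u 0 - p 0 * u 2),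
    (starRingEnd ℂ) (p 0 * u 1 - p 1 * u 0)]

lemma C3_ext {z w : C3} (h0 : z 0 = w 0) (h1 : z 1 = w 1) (h2 : z 2 = w 2) : z = w := by
  ext i
  fin_cases i <;> assumption

/-- Replaces the octonion product by a complex cross product, whose behaviour under `SU(3)` is
governed by the determinant. -/
lemma ofImO_octCross (p u : C3) : ofImO (octCross (toImO p) (toImO u)) = hcross p u := by
  apply C3_ext <;> apply Complex.ext <;>
    simp [ofImO, octCross, toImO, hcross] <;> ring

lemma hcross_add_right (p u v : C3) : hcross p (u + v) = hcross p u + hcross p v := by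
  apply C3_ext <;> simp [hcross] <;> ring

lemma hcross_smul_right (p : C3) (a : ℝ) (u : C3) : hcross p (a • u) = a • hcross p u := by
  apply C3_ext <;> simp [hcross, Complex.real_smul] <;> ring

lemma hcross_self (p : C3) : hcross p p = 0 := by
  apply C3_ext <;> simp [hcross] <;> ring

lemma hcross_I_smul (p u : C3) : hcross p (Complex.I • u) = -(Complex.I • hcross p u) := by
  apply C3_ext <;> simp [hcross] <;> ring

lemma inner_hcross (p u v : C3) : inner ℝ (hcross p u) v = - inner ℝ u (hcross p v) := by
  simp [inner_C3, hcross]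
  ring

lemma inner_self_hcross (p u : C3) : inner ℝ p (hcross p u) = 0 := by
  simp [inner_C3, hcross]
  ring

lemma inner_I_smul_hcross (p u : C3) : inner ℝ (Complex.I • p) (hcross p u) = 0 := by
  simp [inner_C3, hcross]
  ring

/-- The double cross product identity: for unit `p`, the square of `hcross p` is `-1` on the
complement of the complex line of `p` and `0` on that line. -/
lemma hcross_hcross (p u : C3) : hcross p (hcross p u) =
    inner ℝ p u • p + inner ℝ (Complex.I • p) u • (Complex.I • p) - inner ℝ p p • u := by
  simp only [inner_C3]
  apply C3_ext <;> apply Complex.ext <;> simp [hcross] <;> ring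

lemma inner_I_smul_left (u v : C3) : inner ℝ (Complex.I • u) v = - inner ℝ u (Complex.I • v) := by
  simp [inner_C3]
  ring

lemma I_smul_I_smul (u : C3) : Complex.I • Complex.I • u = -u := by
  rw [smul_smul, Complex.I_mul_I, neg_one_smul]

lemma inner_coe_I_smul (p : C3) : inner ℝ p (Complex.I • p) = 0 := by
  simp [inner_C3]
  ring

lemma I_smul_real_smul (a : ℝ) (u : C3) : Complex.I • a • u = a • Complex.I • u :=
  smul_comm _ _ _

/-! ### The structure tensors -/

lemma incl_xi (p : S5) : incl p (xi p) = -(Complex.I • (p : C3)) := by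
  apply incl_tangentialPart_of_inner_eq_zero
  rw [inner_neg_right, inner_coe_I_smul, neg_zero]

lemma eta_eq (p : S5) (x : T p) : eta p x = g p (xi p) x := by
  rw [eta, g, incl_xi, inner_neg_left, inner_I_smul_left, real_inner_comm, inner_I_smul_left,
    neg_neg, real_inner_comm]

lemma incl_psi (p : S5) (x : T p) :
    incl p (psi p x) = Complex.I • incl p x - eta p x • (p : C3) := by
  rw [psi, incl_tangentialPart, eta, real_inner_comm]

lemma incl_psiHat (p : S5) (x : T p) : incl p (psiHat p x) = hcross (p : C3) (incl p x) := by
  rw [psiHat, ofImO_octCross]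
  exact incl_tangentialPart_of_inner_eq_zero p (inner_self_hcross _ _)

lemma psi_add (p : S5) (x y : T p) : psi p (x + y) = psi p x + psi p y := by
  simp only [psi, map_add, smul_add]

lemma psi_smul (p : S5) (a : ℝ) (x : T p) : psi p (a • x) = a • psi p x := by
  simp only [psi, map_smul, I_smul_real_smul]

lemma psiHat_add (p : S5) (x y : T p) : psiHat p (x + y) = psiHat p x + psiHat p y := by
  simp only [psiHat, ofImO_octCross, map_add, hcross_add_right]

lemma psiHat_smul (p : S5) (a : ℝ) (x : T p) : psiHat p (a • x) = a • psiHat p x := by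
  simp only [psiHat, ofImO_octCross, map_smul, hcross_smul_right]

lemma g_xi_xi (p : S5) : g p (xi p) (xi p) = 1 := by
  rw [g, incl_xi, inner_neg_neg, inner_I_smul_left, I_smul_I_smul, inner_neg_right, neg_neg,
    inner_coe_self]

lemma g_psi (p : S5) (x y : T p) : g p (psi p x) y = - g p x (psi p y) := by
  rw [g, g, incl_psi, incl_psi, inner_sub_left, inner_sub_right, real_inner_smul_left,
    real_inner_smul_right, inner_coe_incl, inner_incl_coe, inner_I_smul_left]
  ring

lemma g_psiHat (p : S5) (x y : T p) : g p (psiHat p x) y = - g p x (psiHat p y) := by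
  rw [g, g, incl_psiHat, incl_psiHat, inner_hcross]

lemma eta_psi (p : S5) (x : T p) : eta p (psi p x) = 0 := by
  rw [eta, incl_psi, smul_sub, inner_sub_left, I_smul_I_smul, inner_neg_left, inner_incl_coe,
    I_smul_real_smul, real_inner_smul_left, real_inner_comm, inner_coe_I_smul]
  ring

lemma eta_psiHat (p : S5) (x : T p) : eta p (psiHat p x) = 0 := by
  rw [eta, incl_psiHat, inner_I_smul_left, real_inner_comm, inner_I_smul_hcross, neg_zero]

lemma psi_xi (p : S5) : psi p (xi p) = 0 := by
  apply incl_injective p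
  rw [incl_psi, eta_eq, g_xi_xi, incl_xi, smul_neg, I_smul_I_smul, neg_neg, one_smul, sub_self,
    map_zero]

lemma psiHat_xi (p : S5) : psiHat p (xi p) = 0 := by
  apply incl_injective p
  rw [incl_psiHat, incl_xi, ← neg_one_smul ℝ, hcross_smul_right, hcross_I_smul, hcross_self,
    smul_zero, neg_zero, smul_zero, map_zero]

lemma psi_psi (p : S5) (x : T p) : psi p (psi p x) = -x + eta p x • xi p := by
  apply incl_injective p
  rw [incl_psi, eta_psi, incl_psi, smul_sub, I_smul_I_smul, I_smul_real_smul, map_add, map_neg,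
    map_smul, incl_xi]
  module

lemma psiHat_psiHat (p : S5) (x : T p) : psiHat p (psiHat p x) = -x + eta p x • xi p := by
  apply incl_injective p
  rw [incl_psiHat, incl_psiHat, hcross_hcross, inner_coe_incl, inner_coe_self, map_add, map_neg,
    map_smul, incl_xi, eta, inner_I_smul_left, real_inner_comm]
  module

/-- Because `hcross` is conjugate-linear. With `psi_psi` and `psiHat_psiHat` this gives the
quaternion relations on the kernel of `η`. -/
lemma psiHat_psi (p : S5) (x : T p) : psiHat p (psi p x) = - psi p (psiHat p x) := by
  apply incl_injective p
  rw [incl_psiHat, incl_psi, map_neg, incl_psi, incl_psiHat, eta_psiHat, sub_eq_add_neg,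
    ← neg_smul, hcross_add_right, hcross_smul_right, hcross_self, hcross_I_smul]
  module

/-- The skew endomorphism `r ψ + Re q ψψ̂ - Im q ψ̂` behind `diffTensor r q`. -/
def Jmap (r : ℝ) (q : ℂ) (p : S5) : T p →ₗ[ℝ] T p where
  toFun x := r • psi p x + q.re • psi p (psiHat p x) - q.im • psiHat p x
  map_add' x y := by simp only [psi_add, psiHat_add]; module
  map_smul' a x := by simp only [psi_smul, psiHat_smul, RingHom.id_apply]; module

variable (r : ℝ) (q : ℂ) (p : S5)

lemma Jmap_apply (x : T p) :
    Jmap r q p x = r • psi p x + q.re • psi p (psiHat p x) - q.im • psiHat p x := rfl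

lemma g_Jmap (x y : T p) : g p (Jmap r q p x) y = - g p x (Jmap r q p y) := by
  simp only [Jmap_apply, g_add_left, g_add_right, g_sub_left, g_sub_right, g_smul_left,
    g_smul_right]
  rw [g_psi, g_psi, g_psiHat, psiHat_psi, g_neg_right, g_psiHat]
  ring

lemma Jmap_xi : Jmap r q p (xi p) = 0 := by
  rw [Jmap_apply, psiHat_xi, psi_xi, ← zero_smul ℝ (0 : T p), psi_smul]
  simp

lemma eta_add (x y : T p) : eta p (x + y) = eta p x + eta p y := by
  simp only [eta_eq, g_add_right]

lemma eta_smul (a : ℝ) (x : T p) : eta p (a • x) = a * eta p x := by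
  simp only [eta_eq, g_smul_right]

lemma eta_Jmap (x : T p) : eta p (Jmap r q p x) = 0 := by
  rw [eta_eq, g_comm, g_Jmap, Jmap_xi, g_comm, g_zero_left, neg_zero]

/-- `ψ`, `ψ̂` and `ψψ̂` anticommute pairwise, so only the three squares survive. -/
lemma Jmap_Jmap (x : T p) :
    Jmap r q p (Jmap r q p x) = (r ^ 2 + ‖q‖ ^ 2) • (-x + eta p x • xi p) := by
  have hneg : ∀ x : T p, psi p (-x) = -psi p x := fun x => by
    rw [← neg_one_smul ℝ x, psi_smul, neg_one_smul]
  have h0 : psi p 0 = 0 := by simpa using psi_smul p 0 0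
  rw [Complex.sq_norm, Complex.normSq_apply]
  simp only [Jmap_apply, sub_eq_add_neg, ← neg_smul, psi_add, psi_smul, psiHat_add, psiHat_smul,
    psiHat_psi, psi_psi, psiHat_psiHat, eta_psiHat, psi_xi, hneg, h0]
  module

/-- The parameters enter only through `J`: paired with a third vector, this is the 3-form `η ∧ g(·,
J ·)`. -/
lemma diffTensor_eq (x y : T p) : diffTensor r q p x y =
    -eta p x • Jmap r q p y + eta p y • Jmap r q p x + g p x (Jmap r q p y) • xi p := by
  simp only [diffTensor, Jmap_apply, Phi, g_add_right, g_sub_right, g_smul_right]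
  rw [g_psiHat p x (psi p y), psiHat_psi, g_neg_right, g_psiHat p x y]
  module

lemma diffTensor_swap (x y : T p) : diffTensor r q p x y = - diffTensor r q p y x := by
  rw [diffTensor_eq, diffTensor_eq, g_comm, g_Jmap]
  module

lemma diffTensor_skew (x y z : T p) :
    g p (diffTensor r q p x y) z = - g p y (diffTensor r q p x z) := by
  simp only [diffTensor_eq, g_add_left, g_add_right, g_smul_left, g_smul_right, ← eta_eq]
  rw [g_comm p y (xi p), ← eta_eq, g_Jmap, g_Jmap r q p x z, g_comm p y (Jmap r q p x),
    g_Jmap r q p x y]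
  ring

lemma diffTensor_diffTensor (x y z : T p) :
    diffTensor r q p y (diffTensor r q p x z) =
      (r ^ 2 + ‖q‖ ^ 2) • ((eta p y * eta p z) • x - (eta p y * eta p x) • z
        + (eta p x * g p y z - eta p z * g p y x) • xi p) + g p x (Jmap r q p z) • Jmap r q p y := by
  have hJ : Jmap r q p (diffTensor r q p x z) =
      (r ^ 2 + ‖q‖ ^ 2) • (eta p x • z - eta p z • x) := by
    rw [diffTensor_eq, map_add, map_add, map_smul, map_smul, map_smul, Jmap_Jmap, Jmap_Jmap,
      Jmap_xi]
    module
  have he : eta p (diffTensor r q p x z) = g p x (Jmap r q p z) := by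
    rw [diffTensor_eq, eta_add, eta_add, eta_smul, eta_smul, eta_smul, eta_Jmap, eta_Jmap,
      eta_eq p (xi p), g_xi_xi]
    ring
  rw [diffTensor_eq r q p y, hJ, he, g_smul_right, g_sub_right, g_smul_right, g_smul_right]
  module

/-! ### Traces -/

instance finite_T (p : S5) : Module.Finite ℝ (T p) := Module.Finite.of_basis (tangentBasis p)

lemma finrank_T (p : S5) : finrank ℝ (T p) = 5 := by
  rw [finrank_eq_card_basis (tangentBasis p), Fintype.card_fin]

lemma trace_eq_zero_of_skew {p : S5} (L : T p →ₗ[ℝ] T p) (h : ∀ x, g p (L x) x = 0) :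
    LinearMap.trace ℝ (T p) L = 0 := by
  rw [← LinearMap.trace_conj' L (tangentEquiv p),
    LinearMap.trace_eq_sum_inner _ (stdOrthonormalBasis ℝ _)]
  refine Finset.sum_eq_zero fun i _ => ?_
  have h1 := h ((tangentEquiv p).symm (stdOrthonormalBasis ℝ _ i))
  rw [real_inner_comm, Submodule.coe_inner]
  refine Eq.trans ?_ h1
  unfold g
  rw [← coe_tangentEquiv, ← coe_tangentEquiv, LinearEquiv.apply_symm_apply]
  rfl

/-- The linear form `g(·, y)`. -/
def gForm (p : S5) (y : T p) : T p →ₗ[ℝ] ℝ where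
  toFun x := g p x y
  map_add' x x' := g_add_left p x x' y
  map_smul' a x := g_smul_left p a x y

@[simp] lemma gForm_apply (p : S5) (y x : T p) : gForm p y x = g p x y := rfl

lemma trace_smulRight_gForm (p : S5) (y z : T p) :
    LinearMap.trace ℝ (T p) ((gForm p y).smulRight z) = g p z y := by
  rw [LinearMap.trace_smulRight, gForm_apply]

lemma sum_repr_eq_trace {p : S5} (L : T p →ₗ[ℝ] T p) {f : T p → T p} (h : ∀ x, f x = L x) :
    ∑ i, (tangentBasis p).repr (f (tangentBasis p i)) i = LinearMap.trace ℝ (T p) L := by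
  rw [LinearMap.trace_eq_matrix_trace ℝ (tangentBasis p), Matrix.trace]
  refine Finset.sum_congr rfl fun i _ => ?_
  rw [h, Matrix.diag_apply, LinearMap.toMatrix_apply]

/-! ### Curvature -/

lemma IsSmoothVF.sub {X Y : VF} (hX : IsSmoothVF X) (hY : IsSmoothVF Y) : IsSmoothVF (X - Y) :=
  ContMDiff.sub_section hX hY

lemma conn_add (D : Conn) {X Y : VF} (hX : IsSmoothVF X) (hY : IsSmoothVF Y) (p : S5) :
    D (X + Y) p = D X p + D Y p :=
  D.isCovariantDerivativeOnUniv.add (hX.mdifferentiableAt p) (hY.mdifferentiableAt p)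

lemma conn_smul_const (D : Conn) {X : VF} (hX : IsSmoothVF X) (a : ℝ) (p : S5) :
    D (a • X) p = a • D X p :=
  D.isCovariantDerivativeOnUniv.smul_const a (hX.mdifferentiableAt p)

lemma extendVF_add {p : S5} (x y : T p) : extendVF (x + y) = extendVF x + extendVF y :=
  funext fun q => by simp [extendVF]

lemma extendVF_smul {p : S5} (a : ℝ) (x : T p) : extendVF (a • x) = a • extendVF x :=
  funext fun q => by simp [extendVF]

lemma nabla_lc_extendVF_extendVF {p : S5} (y z : T p) : nabla lc (extendVF y) (extendVF z) =
    (fun q : S5 => -inner ℝ (q : C3) (incl p z)) • extendVF y := by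
  funext q
  rw [nabla, nabla_lc_extendVF, ← neg_smul]
  rfl

/-- The coefficient of `extendVF y` in the inner derivative vanishes at `p`, so only its own
derivative survives. This is the source of the constant curvature of the sphere. -/
lemma lc_nabla_lc_extendVF {p : S5} (x y z : T p) :
    lc (nabla lc (extendVF y) (extendVF z)) p x = -(g p x z • y) := by
  have hf : MDifferentiableAt (𝓡 5) 𝓘(ℝ, ℝ) (fun q : S5 => -inner ℝ (q : C3) (incl p z)) p := by
    have h : Differentiable ℝ (fun v : C3 => (-inner ℝ v (incl p z) : ℝ)) :=
      (differentiable_id.inner ℝ (differentiable_const _)).neg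
    exact (h _).mdifferentiableAt.comp p (mdifferentiableAt_coe p)
  have hd : mvfderiv (𝓡 5) (fun q : S5 => -(inner ℝ (q : C3) (incl p z) : ℝ)) p x = -g p x z := by
    have h := mvfderiv_inner (mdifferentiableAt_coe p) (mdifferentiableAt_const (c := incl p z)) x
    rw [mvfderiv_const] at h
    rw [mvfderiv_fun_neg, _root_.neg_apply, h]
    simp [g, incl]
  rw [nabla_lc_extendVF_extendVF, lc.isCovariantDerivativeOnUniv.leibniz
    ((isSmoothVF_extendVF y).mdifferentiableAt p) hf]
  rw [_root_.add_apply, _root_.smul_apply, ContinuousLinearMap.smulRight_apply, hd,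
    nabla_lc_extendVF, extendVF_self, inner_coe_incl]
  simp

variable {D : Conn} {r : ℝ} {q : ℂ}

/-- The field `diffTensor r q (Y, Z)`, for the extensions `Y`, `Z` of `y`, `z`. -/
def diffVF (r : ℝ) (q : ℂ) {p : S5} (y z : T p) : VF :=
  fun s => diffTensor r q s (extendVF y s) (extendVF z s)

lemma HasParameters.nabla_extendVF (h : HasParameters lc D r q) {p : S5} (y z : T p) :
    nabla D (extendVF y) (extendVF z) = nabla lc (extendVF y) (extendVF z) + diffVF r q y z :=
  funext fun s => h _ _ (isSmoothVF_extendVF y) (isSmoothVF_extendVF z) s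

lemma HasParameters.isSmoothVF_diffVF (h : HasParameters lc D r q) (hD : IsSmoothConn D) {p : S5}
    (y z : T p) : IsSmoothVF (diffVF r q y z) := by
  have hy := isSmoothVF_extendVF y
  have hz := isSmoothVF_extendVF z
  have h1 : diffVF r q y z =
      nabla D (extendVF y) (extendVF z) - nabla lc (extendVF y) (extendVF z) := by
    rw [h.nabla_extendVF, add_sub_cancel_left]
  rw [h1]
  exact (hD.isSmoothVF hy hz).sub (lc_isSmoothConn.isSmoothVF hy hz)

lemma diffTensor_add_left (p : S5) (x y z : T p) :
    diffTensor r q p (x + y) z = diffTensor r q p x z + diffTensor r q p y z := by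
  simp only [diffTensor_eq, eta_add, map_add, g_add_left]
  module

lemma diffTensor_smul_left (p : S5) (a : ℝ) (x z : T p) :
    diffTensor r q p (a • x) z = a • diffTensor r q p x z := by
  simp only [diffTensor_eq, eta_smul, map_smul, g_smul_left]
  module

/-- The extensions commute at `p` and are `lc`-parallel there, so the bracket term and the mixed
terms `B(x, ∇^g_y z)` drop out. -/
lemma HasParameters.curvature_eq (h : HasParameters lc D r q) (hD : IsSmoothConn D) (p : S5)
    (x y z : T p) : curvature D p x y z =
      g p y z • x - g p x z • y + lc (diffVF r q y z) p x - lc (diffVF r q x z) p y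
        + diffTensor r q p x (diffTensor r q p y z)
        - diffTensor r q p y (diffTensor r q p x z) := by
  have key : ∀ x y : T p, nabla D (extendVF x) (nabla D (extendVF y) (extendVF z)) p =
      -(g p x z • y) + lc (diffVF r q y z) p x + diffTensor r q p x (diffTensor r q p y z) := by
    intro x y
    have hy := isSmoothVF_extendVF y
    have hz := isSmoothVF_extendVF z
    rw [h _ _ (isSmoothVF_extendVF x) (hD.isSmoothVF hy hz) p, h.nabla_extendVF, nabla,
      conn_add lc (lc_isSmoothConn.isSmoothVF hy hz) (h.isSmoothVF_diffVF hD y z),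
      _root_.add_apply, extendVF_self, lc_nabla_lc_extendVF]
    have h0 : (nabla lc (extendVF y) (extendVF z) + diffVF r q y z) p = diffTensor r q p y z := by
      rw [Pi.add_apply, nabla, nabla_lc_extendVF, diffVF, inner_coe_incl, extendVF_self,
        extendVF_self]
      simp
    rw [h0]
  have hb : nabla D (VectorField.mlieBracket (𝓡 5) (extendVF x) (extendVF y)) (extendVF z) p = 0 := by
    rw [nabla, mlieBracket_extendVF, map_zero]
  show nabla D _ _ p - nabla D _ _ p - nabla D _ _ p = _
  rw [key, key, hb]
  abel

/-- The map `x ↦ ∇_y (diffTensor r q (X, Z))`, for the extensions `X`, `Z` of `x`, `z`. -/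
def HasParameters.derivLin (h : HasParameters lc D r q) (hD : IsSmoothConn D) {p : S5}
    (y z : T p) : T p →ₗ[ℝ] T p where
  toFun x := lc (diffVF r q x z) p y
  map_add' x x' := by
    have h1 : diffVF r q (x + x') z = diffVF r q x z + diffVF r q x' z := funext fun s => by
      rw [diffVF, extendVF_add, Pi.add_apply, diffTensor_add_left]; rfl
    rw [h1, conn_add lc (h.isSmoothVF_diffVF hD x z) (h.isSmoothVF_diffVF hD x' z),
      _root_.add_apply]
  map_smul' a x := by
    have h1 : diffVF r q (a • x) z = a • diffVF r q x z := funext fun s => by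
      rw [diffVF, extendVF_smul, Pi.smul_apply, diffTensor_smul_left]; rfl
    rw [h1, conn_smul_const lc (h.isSmoothVF_diffVF hD x z), _root_.smul_apply, RingHom.id_apply]

lemma g_diffTensor_self (p : S5) (x z : T p) : g p (diffTensor r q p x z) x = 0 := by
  have h1 := diffTensor_skew r q p x x z
  have h2 := diffTensor_swap r q p x x
  have h3 : diffTensor r q p x x = 0 := by
    rw [eq_neg_iff_add_eq_zero, ← two_smul ℝ] at h2
    exact (smul_eq_zero.1 h2).resolve_left two_ne_zero
  rw [h3, g_zero_left] at h1
  rw [g_comm]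
  linarith

/-- Differentiate `g(B(X, Z), X) = 0` along `Y`, with `X` parallel at `p`. -/
lemma HasParameters.g_derivLin (h : HasParameters lc D r q) (hD : IsSmoothConn D) {p : S5}
    (x y z : T p) : g p (h.derivLin hD y z x) x = 0 := by
  have h1 := lc_isMetric (extendVF y) (diffVF r q x z) (extendVF x) (isSmoothVF_extendVF y)
    (h.isSmoothVF_diffVF hD x z) (isSmoothVF_extendVF x) p
  have h0 : (fun s => g s (diffVF r q x z s) (extendVF x s)) = fun _ => 0 :=
    funext fun s => g_diffTensor_self s _ _
  rw [h0, mvfderiv_const] at h1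
  have h2 : nabla lc (extendVF y) (extendVF x) p = 0 := by
    rw [nabla, nabla_lc_extendVF, inner_coe_incl, zero_smul, neg_zero]
  rw [h2, g_comm p _ 0, g_zero_left, add_zero, extendVF_self, nabla, extendVF_self] at h1
  rw [extendVF_self] at h1
  exact h1.symm

/-- `L4` and `derivLin` are skew, hence traceless; the round part gives `(5 - 1) g`, and `L5` has
trace `2c (g + η ⊗ η)`. The trace left in the statement is the divergence of the difference tensor.
-/
lemma HasParameters.ricci_eq (h : HasParameters lc D r q) (hD : IsSmoothConn D) (p : S5)
    (y z : T p) : ricci D p y z =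
      (4 - 2 * (r ^ 2 + ‖q‖ ^ 2)) * g p y z - 2 * (r ^ 2 + ‖q‖ ^ 2) * (eta p y * eta p z)
        + LinearMap.trace ℝ (T p) (lc (diffVF r q y z) p) := by
  set c := r ^ 2 + ‖q‖ ^ 2 with hc
  set w := diffTensor r q p y z with hw
  let L4 : T p →ₗ[ℝ] T p :=
    { toFun := fun x => diffTensor r q p x w
      map_add' := fun x x' => diffTensor_add_left p x x' w
      map_smul' := fun a x => diffTensor_smul_left p a x w }
  let e := gForm p (xi p)
  -- `diffTensor_diffTensor` regrouped as a multiple of the identity plus rank-one maps, whose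
  -- traces can be read off.
  let L5 : T p →ₗ[ℝ] T p :=
    c • ((eta p y * eta p z) • LinearMap.id - eta p y • e.smulRight z
        + (e.smulRight (g p y z • xi p) - eta p z • (gForm p y).smulRight (xi p)))
      + (gForm p (Jmap r q p z)).smulRight (Jmap r q p y)
  let L : T p →ₗ[ℝ] T p :=
    g p y z • LinearMap.id - (gForm p z).smulRight y + (lc (diffVF r q y z) p : T p →ₗ[ℝ] T p)
      - h.derivLin hD y z + L4 - L5
  have hL : ∀ x, curvature D p x y z = L x := by
    intro x
    rw [h.curvature_eq hD, diffTensor_diffTensor r q p x y z, ← hc]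
    have he : eta p x = g p x (xi p) := by rw [eta_eq, g_comm]
    show _ = g p y z • x - g p x z • y + lc (diffVF r q y z) p x - lc (diffVF r q x z) p y
      + diffTensor r q p x w - (c • ((eta p y * eta p z) • x - eta p y • (g p x (xi p) • z)
        + (g p x (xi p) • (g p y z • xi p) - eta p z • (g p x y • xi p)))
      + g p x (Jmap r q p z) • Jmap r q p y)
    rw [← he, g_comm p y x]
    module
  unfold ricci
  rw [sum_repr_eq_trace (f := fun x => curvature D p x y z) L hL]
  have t4 : LinearMap.trace ℝ (T p) L4 = 0 :=
    trace_eq_zero_of_skew L4 fun x => g_diffTensor_self p x w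
  have t3 : LinearMap.trace ℝ (T p) (h.derivLin hD y z) = 0 :=
    trace_eq_zero_of_skew _ fun x => h.g_derivLin hD x y z
  have hfr : LinearMap.trace ℝ (T p) LinearMap.id = 5 := by
    rw [LinearMap.trace_id, finrank_T]; norm_num
  have hJJ : g p (Jmap r q p y) (Jmap r q p z) = c * (g p y z - eta p y * eta p z) := by
    rw [g_Jmap, Jmap_Jmap, g_smul_right, g_add_right, g_neg_right, g_smul_right, g_comm p y (xi p),
      ← eta_eq]
    ring
  have e1 : eta p z = g p z (xi p) := by rw [eta_eq, g_comm]
  have e2 : eta p y = g p y (xi p) := by rw [eta_eq, g_comm]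
  simp only [L, L5, e, map_add, map_sub, map_smul, t3, t4, hfr, trace_smulRight_gForm, hJJ,
    smul_eq_mul, g_smul_left, g_xi_xi]
  rw [← e1, ← eta_eq]
  ring

/-- By `diffTensor_swap` the divergence term is skew in `y, z`, so symmetrization removes it. -/
theorem HasParameters.symRicci_eq (h : HasParameters lc D r q) (hD : IsSmoothConn D) (p : S5)
    (y z : T p) : symRicci D p y z =
      (4 - 2 * (r ^ 2 + ‖q‖ ^ 2)) * g p y z - 2 * (r ^ 2 + ‖q‖ ^ 2) * (eta p y * eta p z) := by
  have hsw : (lc (diffVF r q z y) p : T p →ₗ[ℝ] T p) = -(lc (diffVF r q y z) p) := by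
    have h1 : diffVF r q z y = (-1 : ℝ) • diffVF r q y z := funext fun s => by
      rw [Pi.smul_apply, neg_one_smul]
      exact diffTensor_swap r q s _ _
    rw [h1, conn_smul_const lc (h.isSmoothVF_diffVF hD y z), neg_one_smul]
    rfl
  rw [symRicci, h.ricci_eq hD, h.ricci_eq hD, hsw, map_neg, g_comm p z y]
  ring

/-! ### The action of `SU(3)` -/

/-- `SU(3)`. -/
abbrev SU3 : Type := Matrix.specialUnitaryGroup (Fin 3) ℂ

lemma toEuclideanLin_mul (A B : Matrix (Fin 3) (Fin 3) ℂ) (v : C3) :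
    Matrix.toEuclideanLin (A * B) v = Matrix.toEuclideanLin A (Matrix.toEuclideanLin B v) := by
  simp [Matrix.toLpLin_apply, Matrix.mulVec_mulVec]

lemma toEuclideanLin_apply_three (A : Matrix (Fin 3) (Fin 3) ℂ) (v : C3) (i : Fin 3) :
    Matrix.toEuclideanLin A v i = A i 0 * v 0 + A i 1 * v 1 + A i 2 * v 2 := by
  simp [Matrix.toLpLin_apply, Matrix.mulVec, dotProduct, Fin.sum_univ_three]

/-- An element of `SU(3)` as a real linear isometry. -/
def su (σ : SU3) : C3 ≃ₗᵢ[ℝ] C3 where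
  toFun v := Matrix.toEuclideanLin (σ : Matrix (Fin 3) (Fin 3) ℂ) v
  invFun v := Matrix.toEuclideanLin ((σ⁻¹ : SU3) : Matrix (Fin 3) (Fin 3) ℂ) v
  map_add' := map_add _
  map_smul' a v := by
    apply C3_ext <;> simp [toEuclideanLin_apply_three, Complex.real_smul]
  left_inv v := by
    beta_reduce
    rw [← toEuclideanLin_mul]
    have h : ((σ⁻¹ : SU3) : Matrix (Fin 3) (Fin 3) ℂ) * (σ : Matrix (Fin 3) (Fin 3) ℂ) = 1 :=
      congrArg Subtype.val (inv_mul_cancel σ)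
    rw [h]
    simp
  right_inv v := by
    beta_reduce
    rw [← toEuclideanLin_mul]
    have h : (σ : Matrix (Fin 3) (Fin 3) ℂ) * ((σ⁻¹ : SU3) : Matrix (Fin 3) (Fin 3) ℂ) = 1 :=
      congrArg Subtype.val (mul_inv_cancel σ)
    rw [h]
    simp
  norm_map' := norm_toEuclideanLin σ

lemma su_apply (σ : SU3) (v : C3) :
    su σ v = Matrix.toEuclideanLin (σ : Matrix (Fin 3) (Fin 3) ℂ) v := rfl

lemma push_eq (σ : SU3) (X : VF) :
    push σ X = VectorField.mpullback (𝓡 5) (𝓡 5) (isoAct (su σ⁻¹)) X := rfl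

lemma su_I_smul (σ : SU3) (v : C3) : su σ (Complex.I • v) = Complex.I • su σ v := by
  rw [su_apply, map_smul]; rfl

/-- The matrix with columns `u`, `v`, `w`. -/
def colMatrix (u v w : C3) : Matrix (Fin 3) (Fin 3) ℂ :=
  Matrix.of fun i j => (![u, v, w] j : C3) i

lemma inner_hcross_eq_det (u v w : C3) :
    inner ℝ (hcross u v) w = ((colMatrix u v w).det).re := by
  rw [Matrix.det_fin_three]
  simp [inner_C3, hcross, colMatrix]
  ring

lemma colMatrix_mul (A : Matrix (Fin 3) (Fin 3) ℂ) (u v w : C3) :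
    A * colMatrix u v w = colMatrix (Matrix.toEuclideanLin A u) (Matrix.toEuclideanLin A v)
      (Matrix.toEuclideanLin A w) := by
  ext i j
  rw [Matrix.mul_apply, Fin.sum_univ_three]
  fin_cases j <;> simp [colMatrix, toEuclideanLin_apply_three]

/-- Paired with a third vector, `hcross` is the real part of a determinant, which `σ` preserves
because `det σ = 1`. -/
lemma su_hcross (σ : SU3) (u v : C3) : hcross (su σ u) (su σ v) = su σ (hcross u v) := by
  refine ext_inner_right ℝ fun w => ?_
  obtain ⟨w, rfl⟩ := (su σ).surjective w
  rw [LinearIsometryEquiv.inner_map_map, inner_hcross_eq_det, inner_hcross_eq_det, su_apply,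
    su_apply, su_apply, ← colMatrix_mul, Matrix.det_mul,
    (Matrix.mem_specialUnitaryGroup_iff.1 σ.2).2, one_mul]

/-! ### Transitivity -/

/-- The base point `(1, 0, 0)`. -/
def basePoint : S5 := ⟨EuclideanSpace.single 0 1, by simp⟩

lemma exists_hcross_ne_zero (p : S5) : ∃ u : C3, hcross (p : C3) u ≠ 0 := by
  by_contra! h
  have h0 := h (EuclideanSpace.single 0 1)
  have h1 := h (EuclideanSpace.single 1 1)
  have e1 : (p : C3) 1 = 0 := by simpa [hcross] using congrArg (fun z : C3 => z 2) h0
  have e2 : (p : C3) 2 = 0 := by simpa [hcross] using congrArg (fun z : C3 => z 1) h0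
  have e3 : (p : C3) 0 = 0 := by simpa [hcross] using congrArg (fun z : C3 => z 2) h1
  have hp : (p : C3) = 0 := C3_ext e3 e1 e2
  have := norm_coe p
  rw [hp, norm_zero] at this
  exact zero_ne_one this

/-- Any normalized value `a` of `hcross P` is Hermitian-orthogonal to `P`, and `(P, a, hcross P a)`
is a unitary frame of determinant one, used as the columns of `σ`. -/
lemma exists_su_eq (p : S5) : ∃ σ : SU3, isoAct (su σ) basePoint = p := by
  obtain ⟨u, hu⟩ := exists_hcross_ne_zero p
  set P : C3 := (p : C3) with hP
  set a : C3 := ‖hcross P u‖⁻¹ • hcross P u with ha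
  set b : C3 := hcross P a with hb
  have pp : inner ℝ P P = 1 := inner_coe_self p
  have aa : inner ℝ a a = 1 := by
    rw [ha, real_inner_smul_left, real_inner_smul_right, real_inner_self_eq_norm_sq]
    have : ‖hcross P u‖ ≠ 0 := norm_ne_zero_iff.2 hu
    field_simp
  have pa : inner ℝ P a = 0 := by
    rw [ha, real_inner_smul_right, inner_self_hcross, mul_zero]
  have Ipa : inner ℝ (Complex.I • P) a = 0 := by
    rw [ha, real_inner_smul_right, inner_I_smul_hcross, mul_zero]
  have pb : inner ℝ P b = 0 := inner_self_hcross P a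
  have Ipb : inner ℝ (Complex.I • P) b = 0 := inner_I_smul_hcross P a
  have ab : inner ℝ a b = 0 := by
    have h := inner_hcross P a a
    rw [real_inner_comm] at h
    linarith
  have Iab : inner ℝ (Complex.I • a) b = 0 := by
    have h := inner_hcross P a (Complex.I • a)
    rw [hcross_I_smul, inner_neg_right, neg_neg, ← hb, real_inner_comm, inner_I_smul_left] at h
    rw [inner_I_smul_left]
    linarith
  have bb : inner ℝ b b = 1 := by
    rw [hb, inner_hcross, hcross_hcross, pa, Ipa, pp, inner_sub_right]
    simp only [zero_smul, add_zero, inner_zero_right, one_smul, aa]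
    norm_num
  have hdet : (colMatrix P a b).det = 1 := by
    have h1 : ((colMatrix P a b).det).re = 1 := by rw [← inner_hcross_eq_det, ← hb, bb]
    have h2 : ((colMatrix P a b).det).im = 0 := by
      rw [Matrix.det_fin_three, hb]
      simp [hcross, colMatrix]
      ring
    exact Complex.ext h1 h2
  -- The entries are Hermitian products of the columns; their real and imaginary parts are the real
  -- inner products found above.
  have hunit : star (colMatrix P a b) * colMatrix P a b = 1 := by
    simp only [inner_C3] at pp aa pa Ipa pb Ipb ab Iab bb
    simp at Ipa Ipb Iab
    ext i j
    rw [Matrix.mul_apply, Fin.sum_univ_three]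
    fin_cases i <;> fin_cases j <;> apply Complex.ext <;>
      simp [colMatrix, Matrix.star_apply] <;> linarith
  refine ⟨⟨colMatrix P a b, Matrix.mem_specialUnitaryGroup_iff.2
    ⟨Matrix.mem_unitaryGroup_iff'.2 hunit, hdet⟩⟩, Subtype.ext ?_⟩
  rw [coe_isoAct, su_apply]
  apply C3_ext <;> simp [toEuclideanLin_apply_three, colMatrix, basePoint, hP]

/-! ### Equivariance of the structure tensors -/

section equivariance

variable (σ : SU3) {p : S5} {x y : T p} {x' y' : T (isoAct (su σ) p)}

lemma eta_su (hx : incl _ x' = su σ (incl p x)) : eta _ x' = eta p x := by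
  rw [eta, eta, hx, coe_isoAct, ← su_I_smul, LinearIsometryEquiv.inner_map_map]

lemma g_su (hx : incl _ x' = su σ (incl p x)) (hy : incl _ y' = su σ (incl p y)) :
    g _ x' y' = g p x y := by
  rw [g, g, hx, hy, LinearIsometryEquiv.inner_map_map]

lemma psi_su (hx : incl _ x' = su σ (incl p x)) : incl _ (psi _ x') = su σ (incl p (psi p x)) := by
  rw [incl_psi, incl_psi, eta_su σ hx, hx, map_sub, su_I_smul, map_smul, coe_isoAct]

lemma psiHat_su (hx : incl _ x' = su σ (incl p x)) :
    incl _ (psiHat _ x') = su σ (incl p (psiHat p x)) := by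
  rw [incl_psiHat, incl_psiHat, hx, coe_isoAct, su_hcross]

lemma xi_su : incl _ (xi (isoAct (su σ) p)) = su σ (incl p (xi p)) := by
  rw [incl_xi, incl_xi, map_neg, su_I_smul, coe_isoAct]

lemma diffTensor_su (r : ℝ) (q : ℂ) (hx : incl _ x' = su σ (incl p x))
    (hy : incl _ y' = su σ (incl p y)) :
    incl _ (diffTensor r q _ x' y') = su σ (incl p (diffTensor r q p x y)) := by
  have hJ : ∀ {x : T p} {x' : T (isoAct (su σ) p)}, incl _ x' = su σ (incl p x) →
      incl _ (Jmap r q _ x') = su σ (incl p (Jmap r q p x)) := by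
    intro x x' hx
    simp only [Jmap_apply, map_add, map_sub, map_smul]
    rw [psi_su σ hx, psiHat_su σ hx, psi_su σ (psiHat_su σ hx)]
  simp only [diffTensor_eq, map_add, map_smul]
  rw [hJ hx, hJ hy, eta_su σ hx, eta_su σ hy, g_su σ hx (hJ hy), xi_su]

lemma incl_tangentialPart_su (u : C3) :
    incl _ (tangentialPart (isoAct (su σ) p) (su σ u)) = su σ (incl p (tangentialPart p u)) := by
  rw [incl_tangentialPart, incl_tangentialPart, coe_isoAct, LinearIsometryEquiv.inner_map_map,
    map_sub, map_smul]

end equivariance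

/-! ### Invariant `3`-forms at the base point -/

/-- Standard vectors of `ℂ³`. -/
abbrev stdVec (i : Fin 3) : C3 := EuclideanSpace.single i 1

/-- The element `diag(1, i, -i)` of `SU(3)`. -/
def suDiag : SU3 := ⟨!![1, 0, 0; 0, Complex.I, 0; 0, 0, -Complex.I],
  Matrix.mem_specialUnitaryGroup_iff.2 ⟨Matrix.mem_unitaryGroup_iff.2 (by
    ext i j
    fin_cases i <;> fin_cases j <;> simp [Matrix.mul_apply, Fin.sum_univ_three, Matrix.star_apply]),
    by simp [Matrix.det_fin_three]⟩⟩

/-- The element of `SU(3)` fixing the first standard vector and rotating the other two. -/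
def suRot : SU3 := ⟨!![1, 0, 0; 0, 0, -1; 0, 1, 0],
  Matrix.mem_specialUnitaryGroup_iff.2 ⟨Matrix.mem_unitaryGroup_iff.2 (by
    ext i j
    fin_cases i <;> fin_cases j <;> simp [Matrix.mul_apply, Fin.sum_univ_three, Matrix.star_apply]),
    by simp [Matrix.det_fin_three]⟩⟩

lemma su_suDiag (v : C3) : su suDiag v = !₂[v 0, Complex.I * v 1, -(Complex.I * v 2)] := by
  rw [su_apply]
  apply C3_ext <;> simp [toEuclideanLin_apply_three, suDiag]

lemma su_suRot (v : C3) : su suRot v = !₂[v 0, -v 2, v 1] := by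
  rw [su_apply]
  apply C3_ext <;> simp [toEuclideanLin_apply_three, suRot]

lemma isoAct_suDiag : isoAct (su suDiag) basePoint = basePoint := by
  apply Subtype.ext
  rw [coe_isoAct, su_suDiag]
  apply C3_ext <;> simp [basePoint]

lemma isoAct_suRot : isoAct (su suRot) basePoint = basePoint := by
  apply Subtype.ext
  rw [coe_isoAct, su_suRot]
  apply C3_ext <;> simp [basePoint]

lemma C3_decomp (u : C3) : ∃ (a b : ℝ) (v : C3), v 0 = 0 ∧
    u = a • stdVec 0 + b • (Complex.I • stdVec 0) + v := by
  refine ⟨(u 0).re, (u 0).im, !₂[0, u 1, u 2], by simp, ?_⟩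
  apply C3_ext <;> apply Complex.ext <;> simp [Complex.real_smul]

lemma C3_decomp_perp {v : C3} (hv : v 0 = 0) :
    v = (v 1).re • stdVec 1 + (v 1).im • (Complex.I • stdVec 1)
      + (v 2).re • stdVec 2 + (v 2).im • (Complex.I • stdVec 2) := by
  apply C3_ext <;> apply Complex.ext <;> simp [hv, Complex.real_smul]

/-- An alternating `3`-form on `ℂ³` that kills the base point, is invariant under its stabilizer
and has three vanishing coefficients, is zero. -/
lemma eq_zero_of_invariant (V : C3 →ₗ[ℝ] C3 →ₗ[ℝ] C3 →ₗ[ℝ] ℝ)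
    (h12 : ∀ u v w, V v u w = -V u v w) (h23 : ∀ u v w, V u w v = -V u v w)
    (h0 : ∀ v w, V (stdVec 0) v w = 0)
    (hdiag : ∀ u v w, V (su suDiag u) (su suDiag v) (su suDiag w) = V u v w)
    (hrot : ∀ u v w, V (su suRot u) (su suRot v) (su suRot w) = V u v w)
    (ha : V (Complex.I • stdVec 0) (stdVec 1) (Complex.I • stdVec 1) = 0)
    (hb : V (Complex.I • stdVec 0) (stdVec 1) (stdVec 2) = 0)
    (hc : V (Complex.I • stdVec 0) (stdVec 1) (Complex.I • stdVec 2) = 0)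
    (u v w : C3) : V u v w = 0 := by
  have d0 : su suDiag (Complex.I • stdVec 0) = Complex.I • stdVec 0 := by
    rw [su_suDiag]; apply C3_ext <;> simp
  have d1 : su suDiag (stdVec 1) = Complex.I • stdVec 1 := by
    rw [su_suDiag]; apply C3_ext <;> simp
  have d1' : su suDiag (Complex.I • stdVec 1) = -stdVec 1 := by
    rw [su_suDiag]; apply C3_ext <;> simp
  have d2 : su suDiag (stdVec 2) = -(Complex.I • stdVec 2) := by
    rw [su_suDiag]; apply C3_ext <;> simp
  have d2' : su suDiag (Complex.I • stdVec 2) = stdVec 2 := by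
    rw [su_suDiag]; apply C3_ext <;> simp
  have r0 : su suRot (Complex.I • stdVec 0) = Complex.I • stdVec 0 := by
    rw [su_suRot]; apply C3_ext <;> simp
  have r1 : su suRot (stdVec 1) = stdVec 2 := by
    rw [su_suRot]; apply C3_ext <;> simp
  have r1' : su suRot (Complex.I • stdVec 1) = Complex.I • stdVec 2 := by
    rw [su_suRot]; apply C3_ext <;> simp
  set ζ : C3 := Complex.I • stdVec 0 with hζ
  have hself : ∀ u v, V u v v = 0 := fun u v => by
    have := h23 u v v; linarith
  -- Each of the three vanishing coefficients is carried by a stabilizer element to a second one,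
  -- which covers all six coefficients of `β = V ζ`.
  have he : V ζ (stdVec 2) (Complex.I • stdVec 2) = 0 := by
    have := hrot ζ (stdVec 1) (Complex.I • stdVec 1)
    rwa [r0, r1, r1', ha] at this
  have hf : V ζ (Complex.I • stdVec 1) (Complex.I • stdVec 2) = 0 := by
    have := hdiag ζ (stdVec 1) (stdVec 2)
    rw [d0, d1, d2, hb, map_neg] at this
    linarith
  have hg : V ζ (Complex.I • stdVec 1) (stdVec 2) = 0 := by
    have := hdiag ζ (stdVec 1) (Complex.I • stdVec 2)
    rwa [d0, d1, d2', hc] at this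
  have hneg : ∀ {u v}, V ζ u v = 0 → V ζ v u = 0 := fun h => by rw [h23, h, neg_zero]
  have hβ : ∀ {v w : C3}, v 0 = 0 → w 0 = 0 → V ζ v w = 0 := by
    intro v w hv hw
    rw [C3_decomp_perp hv, C3_decomp_perp hw]
    simp only [map_add, map_smul, LinearMap.add_apply, LinearMap.smul_apply, ha, hb, hc, he, hf, hg,
      hneg ha, hneg hb, hneg hc, hneg he, hneg hf, hneg hg, hself, smul_zero, add_zero]
  -- The square of `suDiag` is `-1` on the last two coordinates, and a trilinear form is odd.
  have hperp : ∀ {u v w : C3}, u 0 = 0 → v 0 = 0 → w 0 = 0 → V u v w = 0 := by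
    intro u v w hu hv hw
    have hsq : ∀ {v : C3}, v 0 = 0 → su suDiag (su suDiag v) = -v := by
      intro v hv
      rw [su_suDiag, su_suDiag]
      apply C3_ext <;> simp [hv, ← mul_assoc]
    have := (hdiag _ _ _).trans (hdiag u v w)
    rw [hsq hu, hsq hv, hsq hw] at this
    simp only [map_neg, LinearMap.neg_apply] at this
    linarith
  have hζ0 : ∀ u v, V u (stdVec 0) v = 0 := fun u v => by rw [h12, h0, neg_zero]
  have hζ00 : ∀ u v, V u v (stdVec 0) = 0 := fun u v => by rw [h23, hζ0, neg_zero]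
  have hζζ : ∀ u, V ζ ζ u = 0 := fun u => by
    have := h12 ζ ζ u; linarith
  obtain ⟨a, b, u', hu, rfl⟩ := C3_decomp u
  obtain ⟨c, d, v', hv, rfl⟩ := C3_decomp v
  obtain ⟨e, f, w', hw, rfl⟩ := C3_decomp w
  have k1 : V u' ζ w' = 0 := by rw [h12, hβ hu hw, neg_zero]
  have k2 : V u' v' ζ = 0 := by rw [h23, h12, hβ hu hv, neg_zero, neg_zero]
  have k3 : V ζ v' ζ = 0 := by rw [h23, hζζ, neg_zero]
  rw [← hζ]
  simp only [map_add, map_smul, LinearMap.add_apply, LinearMap.smul_apply, h0, hζ0, hζ00, hζζ,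
    hself, hβ hv hw, k1, k2, k3, hperp hu hv hw, smul_zero, add_zero]

/-! ### Bilinear tensors as trilinear forms on `ℂ³` -/

/-- `(u, v, w) ↦ g(B(u, v), w)`, for the tangential parts of `u`, `v`, `w`. -/
def triForm (p : S5) (B : T p →ₗ[ℝ] T p →ₗ[ℝ] T p) : C3 →ₗ[ℝ] C3 →ₗ[ℝ] C3 →ₗ[ℝ] ℝ :=
  ((B.compl₁₂ (tangentialPart p) (tangentialPart p)).compr₂
    ((innerₗ C3).comp (incl p : T p →ₗ[ℝ] C3))).compr₂
      (LinearMap.lcomp ℝ ℝ ((incl p : T p →ₗ[ℝ] C3) ∘ₗ tangentialPart p))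

lemma triForm_apply (p : S5) (B : T p →ₗ[ℝ] T p →ₗ[ℝ] T p) (u v w : C3) :
    triForm p B u v w =
      g p (B (tangentialPart p u) (tangentialPart p v)) (tangentialPart p w) := rfl

/-- `diffTensor r q` as a bilinear map. -/
def diffTensorLin (r : ℝ) (q : ℂ) (p : S5) : T p →ₗ[ℝ] T p →ₗ[ℝ] T p :=
  LinearMap.mk₂ ℝ (diffTensor r q p) (diffTensor_add_left p) (diffTensor_smul_left p)
    (fun x y z => by
      rw [diffTensor_swap, diffTensor_add_left, neg_add, ← diffTensor_swap, ← diffTensor_swap])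
    (fun a x y => by
      rw [diffTensor_swap, diffTensor_smul_left, ← smul_neg, ← diffTensor_swap])

lemma diffTensorLin_apply (r : ℝ) (q : ℂ) (p : S5) (x y : T p) :
    diffTensorLin r q p x y = diffTensor r q p x y := rfl

/-- At the base point `i e₀` is `-ξ`, so only the term `-η(x) J y` survives. The parameters can be
read off from this 2-form. -/
lemma triForm_diffTensor_base (r : ℝ) (q : ℂ) {v w : C3} (hv : v 0 = 0) (hw : w 0 = 0) :
    triForm basePoint (diffTensorLin r q basePoint) (Complex.I • stdVec 0) v w =
      inner ℝ (r • (Complex.I • v) + q.re • (Complex.I • hcross (stdVec 0) v)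
        - q.im • hcross (stdVec 0) v) w := by
  have hb : (basePoint : C3) = stdVec 0 := rfl
  have hx : tangentialPart basePoint (Complex.I • stdVec 0) = -xi basePoint := by
    rw [xi, ← map_neg, neg_neg, hb]
  have hp : ∀ {v : C3}, v 0 = 0 → incl basePoint (tangentialPart basePoint v) = v := fun {v} hv => by
    apply incl_tangentialPart_of_inner_eq_zero
    rw [hb, inner_C3]
    simp [hv]
  have hpI : ∀ {v : C3}, v 0 = 0 → inner ℝ (Complex.I • v) (stdVec 0) = 0 := fun {v} hv => by
    rw [inner_C3]
    simp [hv]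
  set y := tangentialPart basePoint v with hy
  have hyv : incl basePoint y = v := hp hv
  have hey : eta basePoint y = 0 := by rw [eta, hyv, hb, hpI hv]
  have hxi : g basePoint (-xi basePoint) (Jmap r q basePoint y) = 0 := by
    rw [g_neg_left, ← eta_eq, eta_Jmap, neg_zero]
  have hex : eta basePoint (-xi basePoint) = -1 := by
    rw [eta_eq, g_neg_right, g_xi_xi]
  rw [triForm_apply, diffTensorLin_apply, hx, diffTensor_eq, ← hy, hey, hxi, hex, zero_smul,
    zero_smul, add_zero, add_zero, neg_neg, one_smul, g, hp hw, Jmap_apply, map_sub, map_add,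
    map_smul, map_smul, map_smul, incl_psi, incl_psi, incl_psiHat, eta_psiHat, hey, hyv, hb,
    zero_smul, sub_zero, sub_zero]

lemma IsLeviCivita.hasParameters_iff {Dg D : Conn} (hg : IsLeviCivita Dg) (r : ℝ) (q : ℂ) :
    HasParameters Dg D r q ↔ HasParameters lc D r q := by
  refine forall₂_congr fun X Y => forall₂_congr fun _ hY => ?_
  rw [hg.nabla_eq hY]

/-! ### Invariance of the difference tensor -/

/-- The trilinear form of the difference tensor of `D` and the Levi-Civita connection. -/
def diffForm (D : Conn) (p : S5) : C3 →ₗ[ℝ] C3 →ₗ[ℝ] C3 →ₗ[ℝ] ℝ := triForm p (diff D lc p)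

/-- The trilinear form of `diffTensor r q`. -/
def paramForm (r : ℝ) (q : ℂ) (p : S5) : C3 →ₗ[ℝ] C3 →ₗ[ℝ] C3 →ₗ[ℝ] ℝ :=
  triForm p (diffTensorLin r q p)

lemma paramForm_su (r : ℝ) (q : ℂ) (σ : SU3) (p : S5) (u v w : C3) :
    paramForm r q (isoAct (su σ) p) (su σ u) (su σ v) (su σ w) = paramForm r q p u v w :=
  g_su σ (diffTensor_su σ r q (incl_tangentialPart_su σ u) (incl_tangentialPart_su σ v))
    (incl_tangentialPart_su σ w)

lemma push_inv_eq (σ : SU3) (X : VF) :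
    push σ⁻¹ X = VectorField.mpullback (𝓡 5) (𝓡 5) (isoAct (su σ)) X := by
  rw [push_eq, inv_inv]

lemma diffForm_su {D : Conn} (hD : IsSU3Invariant D) (σ : SU3) (p : S5) (u v w : C3) :
    diffForm D (isoAct (su σ) p) (su σ u) (su σ v) (su σ w) = diffForm D p u v w := by
  -- Extending at `σ p` and pulling back gives fields with the prescribed values at `p`; the
  -- difference tensor sees nothing else of them.
  have key : ∀ u : C3, VectorField.mpullback (𝓡 5) (𝓡 5) (isoAct (su σ))
      (extendVF (tangentialPart (isoAct (su σ) p) (su σ u))) p = tangentialPart p u := by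
    intro u
    apply incl_injective p
    refine (ext_mpullback_isoAct (su σ) _ p).trans ?_
    rw [ext, extendVF_self, incl_tangentialPart_su, LinearIsometryEquiv.symm_apply_apply]
  set x := tangentialPart (isoAct (su σ) p) (su σ u) with hx
  set y := tangentialPart (isoAct (su σ) p) (su σ v) with hy
  have hX := isSmoothVF_extendVF x
  have hY := isSmoothVF_extendVF y
  have h1 := diff_apply D lc (X := VectorField.mpullback (𝓡 5) (𝓡 5) (isoAct (su σ)) (extendVF x))
    (hY.mpullback_isoAct (su σ)) p
  rw [hx, key, hy, key, ← hx, ← hy] at h1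
  have h2 := hD σ⁻¹ _ _ hX hY
  rw [push_inv_eq, push_inv_eq, push_inv_eq] at h2
  rw [← h2, ← mpullback_nabla_lc (su σ) hY] at h1
  have h3 := ext_mpullback_isoAct (su σ) (nabla D (extendVF x) (extendVF y)) p
  have h4 := ext_mpullback_isoAct (su σ) (nabla lc (extendVF x) (extendVF y)) p
  unfold ext at h3 h4
  have h5 : incl _ (diff D lc (isoAct (su σ) p) x y) =
      su σ (incl p (diff D lc p (tangentialPart p u) (tangentialPart p v))) := by
    rw [h1, map_sub, h3, h4, ← map_sub, LinearIsometryEquiv.apply_symm_apply, ← map_sub,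
      diff_eq_extendVF]
  exact g_su σ h5 (incl_tangentialPart_su σ w)

lemma paramForm_swap₁₂ (r : ℝ) (q : ℂ) (p : S5) (u v w : C3) :
    paramForm r q p v u w = - paramForm r q p u v w := by
  simp only [paramForm, triForm_apply, diffTensorLin_apply]
  rw [diffTensor_swap, g_neg_left]

lemma paramForm_swap₂₃ (r : ℝ) (q : ℂ) (p : S5) (u v w : C3) :
    paramForm r q p u w v = - paramForm r q p u v w := by
  simp only [paramForm, triForm_apply, diffTensorLin_apply]
  rw [diffTensor_skew, g_comm]

lemma triForm_coe_left (p : S5) (B : T p →ₗ[ℝ] T p →ₗ[ℝ] T p) (v w : C3) :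
    triForm p B (p : C3) v w = 0 := by
  rw [triForm_apply, tangentialPart_coe, map_zero, LinearMap.zero_apply, g_zero_left]

/-- An invariant metric connection with skew torsion belongs to the three-parameter family. -/
theorem exists_hasParameters {D : Conn} (hi : IsSU3Invariant D) (hm : IsMetric D)
    (hs : HasSkewTorsion D) : ∃ (r : ℝ) (q : ℂ), HasParameters lc D r q := by
  let W := diffForm D basePoint (Complex.I • stdVec 0) (stdVec 1)
  -- Since `hcross e₀ e₁ = e₂`, `triForm_diffTensor_base` with `v = e₁` has coefficients `r`, `Re
  -- q`, `-Im q` along `i e₁`, `i e₂`, `e₂`.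
  let r : ℝ := W (Complex.I • stdVec 1)
  let q : ℂ := ⟨W (Complex.I • stdVec 2), -W (stdVec 2)⟩
  refine ⟨r, q, ?_⟩
  let V : S5 → C3 →ₗ[ℝ] C3 →ₗ[ℝ] C3 →ₗ[ℝ] ℝ := fun p =>
    triForm p (diff D lc p - diffTensorLin r q p)
  have hVapp : ∀ p u v w, V p u v w = diffForm D p u v w - paramForm r q p u v w := fun p u v w =>
    g_sub_left p _ _ _
  have hVsu : ∀ (σ : SU3) (p : S5) (u v w : C3),
      V (isoAct (su σ) p) (su σ u) (su σ v) (su σ w) = V p u v w := fun σ p u v w => by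
    rw [hVapp, hVapp, diffForm_su hi, paramForm_su]
  have h12 : ∀ p u v w, V p v u w = -V p u v w := fun p u v w => by
    rw [hVapp, hVapp, paramForm_swap₁₂, diffForm, triForm_apply, diff_swap hm hs lc_isLeviCivita, g_neg_left,
      triForm_apply]
    ring
  have h23 : ∀ p u v w, V p u w v = -V p u v w := fun p u v w => by
    rw [hVapp, hVapp, paramForm_swap₂₃, diffForm, triForm_apply, diff_skew hm lc_isMetric, g_comm, triForm_apply]
    ring
  have hbase : ∀ u v w, V basePoint u v w = 0 := by
    have hval : ∀ w : C3, w 0 = 0 → V basePoint (Complex.I • stdVec 0) (stdVec 1) w = W w -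
        inner ℝ (r • (Complex.I • stdVec 1) + q.re • (Complex.I • hcross (stdVec 0) (stdVec 1))
          - q.im • hcross (stdVec 0) (stdVec 1)) w := by
      intro w hw
      rw [← triForm_diffTensor_base r q (by simp) hw]
      exact hVapp _ _ _ _
    refine eq_zero_of_invariant (V basePoint) (h12 _) (h23 _) ?_ ?_ ?_ ?_ ?_ ?_
    · intro v w
      rw [hVapp, diffForm, paramForm, show stdVec 0 = (basePoint : C3) from rfl, triForm_coe_left,
        triForm_coe_left, sub_zero]
    · intro u v w
      have h := hVsu suDiag basePoint u v w
      rwa [isoAct_suDiag] at h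
    · intro u v w
      have h := hVsu suRot basePoint u v w
      rwa [isoAct_suRot] at h
    · rw [hval _ (by simp), inner_C3]
      simp [hcross, r]
    · rw [hval _ (by simp), inner_C3]
      simp [hcross, q]
    · rw [hval _ (by simp), inner_C3]
      simp [hcross, q]
  have hV : ∀ p u v w, V p u v w = 0 := by
    intro p u v w
    obtain ⟨σ, hσ⟩ := exists_su_eq p
    rw [← hσ]
    have h := hVsu σ basePoint ((su σ).symm u) ((su σ).symm v) ((su σ).symm w)
    simpa only [LinearIsometryEquiv.apply_symm_apply, hbase] using h
  intro X Y _ hY p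
  rw [← sub_eq_iff_eq_add', ← diff_apply D lc hY p]
  refine eq_of_g_eq fun z => ?_
  have h := hV p (incl p (X p)) (incl p (Y p)) (incl p z)
  rwa [hVapp, diffForm, paramForm, triForm_apply, triForm_apply, diffTensorLin_apply,
    tangentialPart_incl, tangentialPart_incl, tangentialPart_incl, sub_eq_zero] at h

/-! ### Properties of the three-parameter family -/

section family

variable {D : Conn} {r : ℝ} {q : ℂ}

lemma HasParameters.diff_eq (h : HasParameters lc D r q) (p : S5) (x y : T p) :
    diff D lc p x y = diffTensor r q p x y := by
  rw [diff_eq_extendVF, h _ _ (isSmoothVF_extendVF x) (isSmoothVF_extendVF y), add_sub_cancel_left,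
    extendVF_self, extendVF_self]

lemma HasParameters.isMetric (h : HasParameters lc D r q) : IsMetric D := by
  intro X Y Z hX hY hZ p
  rw [lc_isMetric X Y Z hX hY hZ p, h X Y hX hY, h X Z hX hZ, g_add_left, g_add_right,
    diffTensor_skew]
  ring

lemma HasParameters.hasSkewTorsion (h : HasParameters lc D r q) : HasSkewTorsion D := by
  have ht : ∀ p (x y z : T p), torsionForm D p x y z = 2 * g p (diffTensor r q p x y) z := by
    intro p x y z
    have h1 := diff_sub_diff_swap D lc p x y
    rw [lc_torsion, sub_zero, h.diff_eq, h.diff_eq, diffTensor_swap r q p y x, sub_neg_eq_add,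
      ← two_smul ℝ] at h1
    rw [torsionForm, ← h1, g_smul_left]
  intro p x y z
  rw [ht, ht, ht, diffTensor_swap r q p y x, g_neg_left, diffTensor_skew r q p x z y, g_comm p z]
  constructor <;> ring

lemma HasParameters.isSU3Invariant (h : HasParameters lc D r q) : IsSU3Invariant D := by
  intro σ X Y hX hY
  obtain ⟨σ, rfl⟩ : ∃ ρ : SU3, σ = ρ⁻¹ := ⟨σ⁻¹, (inv_inv σ).symm⟩
  rw [push_inv_eq, push_inv_eq, push_inv_eq]
  have hX' := hX.mpullback_isoAct (su σ)
  have hY' := hY.mpullback_isoAct (su σ)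
  have hr : ∀ (X : VF) (p : S5), incl _ (X (isoAct (su σ) p)) =
      su σ (incl p (VectorField.mpullback (𝓡 5) (𝓡 5) (isoAct (su σ)) X p)) := fun X p => by
    have h1 := ext_mpullback_isoAct (su σ) X p
    unfold ext at h1
    rw [h1, LinearIsometryEquiv.apply_symm_apply]
  funext p
  apply incl_injective p
  apply (su σ).injective
  rw [← hr, h X Y hX hY, h _ _ hX' hY', ← mpullback_nabla_lc (su σ) hY, map_add, map_add, map_add,
    ← hr, diffTensor_su σ r q (hr X p) (hr Y p)]

end family

/-! ### `∇`-Einstein connections -/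

lemma diffTensor_zero (p : S5) (x y : T p) : diffTensor 0 0 p x y = 0 := by
  simp [diffTensor]

/-- `scalarCurvature` uses the matrix inverse of the Gram matrix, which is meaningful only if that
matrix is nonsingular. -/
lemma isUnit_det_gram (p : S5) :
    IsUnit (Matrix.of fun i j => g p (tangentBasis p i) (tangentBasis p j)).det := by
  rw [isUnit_iff_ne_zero]
  intro h
  obtain ⟨v, hv, h0⟩ := Matrix.exists_mulVec_eq_zero_iff.2 h
  apply hv
  have hx : ∑ j, v j • tangentBasis p j = 0 := by
    refine eq_of_g_eq fun z => ?_
    rw [g_zero_left, g_comm]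
    have hlin : ∀ z : T p, g p z (∑ j, v j • tangentBasis p j) =
        gForm p (∑ j, v j • tangentBasis p j) z := fun _ => rfl
    rw [hlin]
    suffices gForm p (∑ j, v j • tangentBasis p j) = 0 by rw [this, LinearMap.zero_apply]
    refine (tangentBasis p).ext fun i => ?_
    have hi := congrFun h0 i
    rw [gForm_apply, g_comm, ← gForm_apply, map_sum, LinearMap.zero_apply]
    simp only [Matrix.mulVec, dotProduct, Matrix.of_apply, Pi.zero_apply] at hi
    rw [← hi]
    refine Finset.sum_congr rfl fun j _ => ?_
    rw [map_smul, gForm_apply, g_comm, smul_eq_mul, mul_comm]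
  funext j
  exact Fintype.linearIndependent_iff.1 (tangentBasis p).linearIndependent v hx j

theorem isNablaEinstein_of_hasParameters_zero {D : Conn} (hD : IsSmoothConn D)
    (h : HasParameters lc D 0 0) : IsNablaEinstein D := by
  refine ⟨h.isMetric, h.hasSkewTorsion, fun p x y => ?_⟩
  have hric : ∀ y z : T p, ricci D p y z = 4 * g p y z := by
    intro y z
    have h0 : diffVF 0 0 y z = 0 := funext fun s => diffTensor_zero s _ _
    rw [h.ricci_eq hD, h0, CovariantDerivative.zero]
    simp
  have hsc : scalarCurvature D p = 20 := by
    have hm : (Matrix.of fun i j => ricci D p (tangentBasis p i) (tangentBasis p j)) =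
        (4 : ℝ) • Matrix.of fun i j => g p (tangentBasis p i) (tangentBasis p j) := by
      ext i j
      simp [hric]
    rw [scalarCurvature, hm, Matrix.mul_smul, Matrix.nonsing_inv_mul _ (isUnit_det_gram p),
      Matrix.trace_smul, Matrix.trace_one, Fintype.card_fin]
    norm_num
  rw [hsc, h.symRicci_eq hD]
  norm_num

lemma HasParameters.eq_zero_of_isNablaEinstein {D : Conn} {r : ℝ} {q : ℂ} (hD : IsSmoothConn D)
    (h : HasParameters lc D r q) (hE : IsNablaEinstein D) : r = 0 ∧ q = 0 := by
  have h1 := hE.2.2 basePoint (xi basePoint) (xi basePoint)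
  have hu : incl basePoint (tangentialPart basePoint (stdVec 1)) = stdVec 1 :=
    incl_tangentialPart_of_inner_eq_zero _ (by rw [inner_C3]; simp [basePoint])
  have h2 := hE.2.2 basePoint (tangentialPart basePoint (stdVec 1))
    (tangentialPart basePoint (stdVec 1))
  have hg : g basePoint (tangentialPart basePoint (stdVec 1))
      (tangentialPart basePoint (stdVec 1)) = 1 := by
    rw [g, hu, inner_C3]; simp
  have he : eta basePoint (tangentialPart basePoint (stdVec 1)) = 0 := by
    rw [eta, hu, inner_C3]; simp [basePoint]
  -- On `ξ` and on a unit vector orthogonal to it, `4 - 4c` and `4 - 2c` both equal a fifth of the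
  -- scalar curvature.
  rw [h.symRicci_eq hD, g_xi_xi, eta_eq, g_xi_xi] at h1
  rw [h.symRicci_eq hD, hg, he] at h2
  have hc : r ^ 2 + ‖q‖ ^ 2 = 0 := by linarith
  have hr : r ^ 2 = 0 := by nlinarith [sq_nonneg r, sq_nonneg ‖q‖]
  have hq : ‖q‖ ^ 2 = 0 := by linarith
  exact ⟨pow_eq_zero_iff two_ne_zero |>.1 hr, norm_eq_zero.1 (pow_eq_zero_iff two_ne_zero |>.1 hq)⟩

lemma hasParameters_zero_iff {D Dg : Conn} : HasParameters Dg D 0 0 ↔ SameConnection D Dg := by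
  refine forall₂_congr fun X Y => forall₂_congr fun _ _ => ?_
  simp only [diffTensor_zero, add_zero, funext_iff]

end FiveSphere

end

/-! ### The main theorem. -/

open FiveSphere
theorem mainTheorem8 :
    (∃ Dg : Conn, IsLeviCivita Dg) ∧
    ∀ Dg : Conn, IsLeviCivita Dg →
      (∀ D : Conn, IsSmoothConn D →
        ((IsSU3Invariant D ∧ IsMetric D ∧ HasSkewTorsion D) ↔
          ∃ (r : ℝ) (q : ℂ), HasParameters Dg D r q)) ∧
      (∀ (D : Conn) (r : ℝ) (q : ℂ), IsSmoothConn D → HasParameters Dg D r q →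
        ∀ (p : S5) (x y : T p),
          symRicci D p x y =
            (4 - 2 * (r ^ 2 + ‖q‖ ^ 2)) * g p x y
              - 2 * (r ^ 2 + ‖q‖ ^ 2) * (eta p x * eta p y)) ∧
      (∀ D : Conn, IsSmoothConn D → IsSU3Invariant D → IsMetric D →
        (IsNablaEinstein D ↔ SameConnection D Dg)) := by
  refine ⟨⟨lc, lc_isLeviCivita⟩, fun Dg hg => ?_⟩
  -- Uniqueness of the Levi-Civita connection replaces `Dg` by `lc`, and agreement with `Dg` becomes
  -- the case `r = 0`, `q = 0`.
  simp only [hg.hasParameters_iff, ← hasParameters_zero_iff]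
  refine ⟨fun D _ => ⟨fun ⟨hi, hm, hs⟩ => exists_hasParameters hi hm hs,
      fun ⟨_, _, h⟩ => ⟨h.isSU3Invariant, h.isMetric, h.hasSkewTorsion⟩⟩,
    fun D r q hD h => h.symRicci_eq hD, fun D hD hi hm => ⟨fun hE => ?_,
      isNablaEinstein_of_hasParameters_zero hD⟩⟩
  -- Skew torsion is part of the Einstein condition, so the classification applies.
  obtain ⟨r, q, h⟩ := exists_hasParameters hi hm hE.2.1
  obtain ⟨rfl, rfl⟩ := h.eq_zero_of_isNablaEinstein hD hE
  exact h
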